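/- Let $n\ge 1$, let $0<v_1,\dots,v_n<1$, let $S=\{(i,j): i,j\in\mathbb Z_{\ge 1},\ i+j\le n+1\}$ and $$\mathcal X=\{(x_{ij})_{(i,j)\in S}: x_{ij}\in\mathbb Z_{\ge 0},\ x_{i+1,j}\le x_{ij},\ x_{i,j+1}\le x_{ij}\}.$$ Let $e_{ij}$ be the array with entry $1$ at $(i,j)$ and $0$ elsewhere, and put $x_{0,j}=\infty$ for $2\le j\le n+1$. Let $X^{(v_1,\dots,v_n)}=(X_{ij}(t):(i,j)\in S)$ be the continuous-time Markov process on $\mathcal X$ with the following transition rates: for $(i,j),(i,k)\in S$, $k\le j$, and $x,\ x+e_{ij}+e_{i,j-1}+\dots+e_{ik}\in\mathcal X$, $$q(x,x+e_{ij}+e_{i,j-1}+\dots+e_{ik})=v_{n-j+1}\,(v_{n-j+1}v_{i-1})^{-1_{\{x_{ij}\ge x_{i-1,j+1}\}}}\,1_{\{x_{ij}=x_{i,j-1}=\dots=x_{ik}\}},$$ for $(i,j),(l,j)\in S$, $l\ge i$, and $x,\ x-e_{ij}-e_{i+1,j}-\dots-e_{lj}\in\mathcal X$, $$q(x,x-e_{ij}-e_{i+1,j}-\dots-e_{lj})=v_{n-j+1}^{-1}\,(v_{i-1}v_{n-j+1})^{1_{\{x_{ij}>x_{i-1,j+1}\}}}\,1_{\{x_{ij}=x_{i+1,j}=\dots=x_{lj}\}},$$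 and all other transition rates are zero (for $i=1$ both indicators involving $x_{0,j+1}$ vanish). These rates determine a unique transition semigroup. Let $(g_{ij})_{(i,j)\in S}$ be independent with $P(g_{ij}=k)=(1-v_iv_{n-j+1})(v_iv_{n-j+1})^k$ for $k\ge 0$, and let $G(i,j)=\max_{\pi}\sum_{(a,b)\in\pi}g_{ab}$, where the maximum is over all directed (up and right) nearest-neighbour paths $\pi$ from $(i,j)$ to the line $\{(a,b):a+b=n+1\}$. (i) The process $X^{(v_1,\dots,v_n)}$ has a unique invariant probability measure, and it is the law of $(G(i,j): i+j\le n+1)$. (ii) When the processes are run in stationarity, with time indexed by $\mathbb R$, $$\bigl(X^{(v_1,\dots,v_n)}_{ij}(t)\bigr)_{t\in\mathbb R,\ i+j\le n+1}\ \stackrel{d}{=}\ \bigl(X^{(v_n,\dots,v_1)}_{ji}(-t)\bigr)_{t\in\mathbb R,\ i+j\le n+1},$$ as an equality of laws of processes (that is, of all finite-dimensional distributions). -/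

import Mathlib

open MeasureTheory ProbabilityTheory Filter Topology
open scoped NNReal

noncomputable section

namespace PushBlock

/-! ### Continuous-time Markov chains on a countable state space -/

section Markov

variable {E : Type*} [MeasurableSpace E]

/-- `P` is the (honest) transition function of a continuous-time Markov chain that jumps from `x`
to `y ≠ x` at rate `q x y` and leaves `x` at the total rate `∑_{y ≠ x} q x y`. -/
structure IsTransitionFunction (q : E → E → ℝ) (P : ℝ≥0 → Kernel E E) : Prop where
  isMarkovKernel : ∀ t, IsMarkovKernel (P t)
  zero : P 0 = Kernel.id
  add : ∀ s t, P (s + t) = P t ∘ₖ P s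
  jump_rate : ∀ x y, x ≠ y →
    Tendsto (fun t : ℝ≥0 => (P t x).real {y} / (t : ℝ)) (𝓝[>] 0) (𝓝 (q x y))
  exit_rate : ∀ x,
    Tendsto (fun t : ℝ≥0 => (1 - (P t x).real {x}) / (t : ℝ)) (𝓝[>] 0)
      (𝓝 (∑' y : {y : E // y ≠ x}, q x y))

/-- `μ` is an invariant probability measure of the transition function `P`. -/
def IsInvariantLaw (P : ℝ≥0 → Kernel E E) (μ : Measure E) : Prop :=
  IsProbabilityMeasure μ ∧ ∀ t, Kernel.Invariant (P t) μ

/-- `(X t)_{t ∈ ℝ}` is a stationary Markov process, indexed by the whole real line, with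
transition rates `q`: it is Markov with respect to its own past, with a time-homogeneous transition
function whose rates are `q`, and its one-time marginals do not depend on time. -/
structure IsStationaryMarkov (q : E → E → ℝ) {Ω : Type*} [MeasurableSpace Ω]
    (μ : Measure Ω) (X : ℝ → Ω → E) : Prop where
  measurable : ∀ t, Measurable (X t)
  stationary : ∀ s t, μ.map (X s) = μ.map (X t)
  markov : ∃ P : ℝ≥0 → Kernel E E, IsTransitionFunction q P ∧
    ∀ (s : ℝ) (t : ℝ≥0) (A : Set E), MeasurableSet A →
      μ[(X (s + t) ⁻¹' A).indicator (fun _ => (1 : ℝ)) |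
          ⨆ u : Set.Iic s, MeasurableSpace.comap (X u) inferInstance]
        =ᵐ[μ] fun ω => (P t (X s ω)).real A

end Markov

/-! ### The index set, the state space and the transition rates -/

/-- The triangular index set `{(i, j) : i, j ≥ 1, i + j ≤ n + 1}`. -/
def triangle (n : ℕ) : Finset (ℕ × ℕ) :=
  (Finset.Icc 1 n ×ˢ Finset.Icc 1 n).filter fun p => p.1 + p.2 ≤ n + 1

/-- The sites `(i, j)` of the triangle. -/
abbrev Site (n : ℕ) : Type := {p : ℕ × ℕ // p ∈ triangle n}

/-- The site `(j, i)` for the site `(i, j)`. -/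
def Site.swap {n : ℕ} (s : Site n) : Site n :=
  ⟨(s.1.2, s.1.1), by
    have h := s.2
    simp only [triangle, Finset.mem_filter, Finset.mem_product, Finset.mem_Icc] at h ⊢
    omega⟩

/-- `Next s t`: the site `t` is `s + (1, 0)` or `s + (0, 1)`. -/
def Next {n : ℕ} (s t : Site n) : Prop :=
  t.1 = (s.1.1 + 1, s.1.2) ∨ t.1 = (s.1.1, s.1.2 + 1)

/-- The state space: arrays `x_{ij} ∈ ℤ_{≥ 0}` with `x_{i+1,j} ≤ x_{ij}` and
`x_{i,j+1} ≤ x_{ij}`. -/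
abbrev State (n : ℕ) : Type := {x : Site n → ℕ // ∀ s t, Next s t → x t ≤ x s}

/-- The coordinate `x_{ij}` (only used at sites of the triangle). -/
def coord {n : ℕ} (x : State n) (i j : ℕ) : ℕ :=
  if h : (i, j) ∈ triangle n then x.1 ⟨(i, j), h⟩ else 0

/-- The value `x_{i-1,j+1}`, with the convention `x_{0,j} = ∞`. -/
def modulator {n : ℕ} (x : State n) (i j : ℕ) : ℕ∞ :=
  if i = 1 then ⊤ else (coord x (i - 1) (j + 1) : ℕ∞)

/-- `y = x + e_{ij} + e_{i,j-1} + … + e_{ik}` and `x_{ij} = x_{i,j-1} = … = x_{ik}`. -/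
def IsRightJump {n : ℕ} (x y : State n) (i j k : ℕ) : Prop :=
  (∀ s : Site n, y.1 s = x.1 s + if s.1.1 = i ∧ k ≤ s.1.2 ∧ s.1.2 ≤ j then 1 else 0) ∧
    ∀ p ∈ Finset.Icc k j, coord x i p = coord x i j

/-- `y = x - e_{ij} - e_{i+1,j} - … - e_{lj}` and `x_{ij} = x_{i+1,j} = … = x_{lj}`. -/
def IsLeftJump {n : ℕ} (x y : State n) (i j l : ℕ) : Prop :=
  (∀ s : Site n, x.1 s = y.1 s + if s.1.2 = j ∧ i ≤ s.1.1 ∧ s.1.1 ≤ l then 1 else 0) ∧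
    ∀ p ∈ Finset.Icc i l, coord x p j = coord x i j

open Classical in
/-- The transition rates of the process with push–block interactions, rate-modulating interactions
and a wall. For given `x` and `y` at most one term of the two sums is nonzero. -/
def rate (n : ℕ) (v : ℕ → ℝ) (x y : State n) : ℝ :=
  (∑ s ∈ triangle n, ∑ k ∈ Finset.Icc 1 s.2,
    if IsRightJump x y s.1 s.2 k then
      v (n - s.2 + 1) *
        (if modulator x s.1 s.2 ≤ (coord x s.1 s.2 : ℕ∞)
          then (v (n - s.2 + 1) * v (s.1 - 1))⁻¹ else 1)
    else 0) +
  ∑ s ∈ triangle n, ∑ l ∈ Finset.Icc s.1 (n + 1 - s.2),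
    if IsLeftJump x y s.1 s.2 l then
      (v (n - s.2 + 1))⁻¹ *
        (if modulator x s.1 s.2 < (coord x s.1 s.2 : ℕ∞)
          then v (s.1 - 1) * v (n - s.2 + 1) else 1)
    else 0

/-! ### Point-to-line last passage percolation -/

/-- `p` is a directed (up and right) nearest neighbour path from `s` to the line
`{(i, j) : i + j = n + 1}`. -/
def IsFlatPath {n : ℕ} (s : Site n) (p : List (Site n)) : Prop :=
  p.head? = some s ∧ p.IsChain Next ∧ ∃ e ∈ p.getLast?, e.1.1 + e.1.2 = n + 1

/-- The point-to-line last passage time `G(s)` in the environment `g`. -/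
def lpp {n : ℕ} (g : Site n → ℕ) (s : Site n) : ℕ :=
  sSup {w | ∃ p, IsFlatPath s p ∧ (p.map g).sum = w}

/-- Up-right paths strictly increase `i + j`, so they have no repeated sites -/
theorem IsFlatPath.nodup {n : ℕ} {s : Site n} {p : List (Site n)} (h : IsFlatPath s p) :
    p.Nodup := by
  have h1 : p.Pairwise (fun a b : Site n => a.1.1 + a.1.2 < b.1.1 + b.1.2) := by
    have : (p.map (fun a : Site n => a.1.1 + a.1.2)).IsChain (· < ·) := by
      rw [List.isChain_map]
      refine h.2.1.imp ?_
      rintro a b (hab | hab) <;> rw [hab] <;> simp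
    rw [List.isChain_iff_pairwise, List.pairwise_map] at this
    exact this
  exact h1.imp (fun hab heq => by rw [heq] at hab; exact lt_irrefl _ hab)

theorem exists_isFlatPath {n : ℕ} (s : Site n) : ∃ p, IsFlatPath s p := by
  suffices H : ∀ m (s : Site n), s.1.1 + s.1.2 + m = n + 1 → ∃ p, IsFlatPath s p by
    have h := s.2
    simp only [triangle, Finset.mem_filter, Finset.mem_product, Finset.mem_Icc] at h
    exact H (n + 1 - (s.1.1 + s.1.2)) s (by omega)
  intro m
  induction m with
  | zero => exact fun s hs => ⟨[s], by simpa [IsFlatPath] using hs⟩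
  | succ m ih =>
    intro s hs
    have h := s.2
    simp only [triangle, Finset.mem_filter, Finset.mem_product, Finset.mem_Icc] at h
    obtain ⟨p, hp, hc, he⟩ := ih ⟨(s.1.1 + 1, s.1.2), by
      simp only [triangle, Finset.mem_filter, Finset.mem_product, Finset.mem_Icc]; omega⟩
      (by simp only; omega)
    cases p with
    | nil => simp at hp
    | cons a p =>
      simp only [List.head?_cons, Option.some.injEq] at hp
      refine ⟨s :: a :: p, rfl, ?_, ?_⟩
      · rw [List.isChain_cons_cons]; exact ⟨Or.inl (by rw [hp]), hc⟩
      · simpa using he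

/-- The last passage time is a genuine maximum over a nonempty bounded set of path weights. -/
theorem isGreatest_lpp {n : ℕ} (g : Site n → ℕ) (s : Site n) :
    IsGreatest {w | ∃ p, IsFlatPath s p ∧ (p.map g).sum = w} (lpp g s) := by
  have hne : {w | ∃ p, IsFlatPath s p ∧ (p.map g).sum = w}.Nonempty :=
    (exists_isFlatPath s).imp' (fun p => (p.map g).sum) fun p hp => ⟨p, hp, rfl⟩
  have hb : BddAbove {w | ∃ p, IsFlatPath s p ∧ (p.map g).sum = w} := by
    refine ⟨∑ r, g r, ?_⟩
    rintro w ⟨p, hp, rfl⟩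
    classical
    rw [← List.sum_toFinset g hp.nodup]
    exact Finset.sum_le_sum_of_subset (Finset.subset_univ _)
  exact ⟨Nat.sSup_mem hne hb, fun w hw => le_csSup hb hw⟩

/-- The `g_{ij}` are independent and `g_{ij}` is geometric with parameter `1 - v_i v_{n-j+1}`. -/
structure IsGeometricEnvironment (n : ℕ) (v : ℕ → ℝ) {Ω : Type*} [MeasurableSpace Ω]
    (μ : Measure Ω) (g : Site n → Ω → ℕ) : Prop where
  measurable : ∀ s, Measurable (g s)
  indep : iIndepFun g μ
  law : ∀ (s : Site n) (k : ℕ), μ.real {ω | g s ω = k} =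
    (1 - v s.1.1 * v (n - s.1.2 + 1)) * (v s.1.1 * v (n - s.1.2 + 1)) ^ k

end PushBlock

end

/-! The stationary law and the reversibility are proved together, by exhibiting the time reversal.
Last passage times satisfy `G(i,j) = g(i,j) + max (G(i+1,j)) (G(i,j+1))` with `G = 0` beyond the
triangle. So environments and states are in bijection, and the law of `G` gives a state the product
weight `∏ (1 - p) p ^ incr`, where `p = v_i v_{n-j+1}` at `(i,j)` (`weight`, `lppLaw_singleton`).

Let `q'` be the rates with reversed parameters and `xᵀ` the transposed array. Two facts say that the
reversal of the chain with respect to `weight` is, after transposition, the chain with rates `q'`.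
The first is the balance `w(x) q(x,y) = w(y) q'(yᵀ,xᵀ)` (`weight_mul_rate`): an undone right jump is
a transposed left jump, and a right jump changes at most three increments, whose parameters are
exactly the factors in the two rates. The second is that `x` and `xᵀ` have the same exit rates
(`exitRate_transpose`): an exchange identity on unit squares leaves corrections that telescope to
the boundary and cancel there.

Exit rates are bounded, so the semigroup is unique (a contraction argument for the backward
equation) and is a Poisson mixture of powers of one jump kernel. Reversal passes from the rates to
this kernel, its powers and their mixtures, and summing the reversal relation over the initial state
gives invariance. The empty array is reachable from every state, so the time-one kernel charges it
from everywhere and the invariant law is unique.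

A stationary process therefore has the passage-time law as its marginals. Its finite-dimensional
probabilities are `π` times a product of transition probabilities; carrying `π` from the first state
to the last turns the product into that of the reversed chain. -/

noncomputable section

namespace PushBlock

/-! ### Chains with bounded rates: backward equation and uniqueness of the semigroup -/

section Markov

variable {E : Type*}

/-- The rates `q` vanish on the diagonal, have rows of finite support and exit rates at most `C`. -/
structure IsBoundedRate (q : E → E → ℝ) (C : ℝ) : Prop where
  nonneg : ∀ x y, 0 ≤ q x y
  diag : ∀ x, q x x = 0
  finite : ∀ x, (Function.support (q x)).Finite
  bound : ∀ x, ∑' y, q x y ≤ C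

theorem IsBoundedRate.tsum_ne {q : E → E → ℝ} {C : ℝ} (hq : IsBoundedRate q C) (x : E) :
    ∑' y : {y : E // y ≠ x}, q x y = ∑' y, q x y := by
  refine tsum_subtype_eq_of_support_subset (f := q x) (s := {y | y ≠ x}) ?_
  rintro y hy rfl
  exact hy (hq.diag _)

theorem IsBoundedRate.tsum_eq {q : E → E → ℝ} {C : ℝ} (hq : IsBoundedRate q C) (x : E) :
    ∑' y, q x y = ∑ y ∈ (hq.finite x).toFinset, q x y :=
  tsum_eq_sum fun y hy => by simpa using hy

variable [MeasurableSpace E]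

theorem IsTransitionFunction.real_mem_Icc {q : E → E → ℝ} {P : ℝ≥0 → Kernel E E}
    (hP : IsTransitionFunction q P) (t : ℝ≥0) (x : E) (A : Set E) :
    (P t x).real A ∈ Set.Icc (0 : ℝ) 1 :=
  have := hP.isMarkovKernel
  ⟨measureReal_nonneg, measureReal_le_one⟩

variable [Countable E]

theorem kernel_ext_singleton {κ η : Kernel E E} (h : ∀ x y, κ x {y} = η x {y}) : κ = η :=
  Kernel.ext fun x => Measure.ext_of_singleton (h x)

variable [MeasurableSingletonClass E]

theorem integrable_of_mem_Icc {μ : Measure E} [IsFiniteMeasure μ] {g : E → ℝ}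
    (hg : ∀ z, g z ∈ Set.Icc (0 : ℝ) 1) : Integrable g μ :=
  Integrable.of_bound (C := 1) (Measurable.of_discrete).aestronglyMeasurable
    (Eventually.of_forall fun z => by
      rw [Real.norm_eq_abs, abs_le]; constructor <;> linarith [(hg z).1, (hg z).2])

/-- Replacing a `[0, 1]`-valued function by its value at `x` off a finite set. -/
theorem abs_integral_sub_le (μ : Measure E) [IsProbabilityMeasure μ] {g : E → ℝ}
    (hg : ∀ z, g z ∈ Set.Icc (0 : ℝ) 1) (x : E) (F : Finset E) (hx : x ∉ F) :
    |∫ z, g z ∂μ - g x - ∑ z ∈ F, μ.real {z} * (g z - g x)| ≤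
      1 - μ.real {x} - ∑ z ∈ F, μ.real {z} := by
  classical
  have hint := integrable_of_mem_Icc (μ := μ) hg
  have h1 : ∫ z, g z ∂μ - g x = ∫ z, (g z - g x) ∂μ := by
    rw [integral_sub hint (integrable_const _)]; simp
  have hint' : Integrable (fun z => g z - g x) μ := hint.sub (integrable_const _)
  have h2 : ∫ z in ↑(insert x F), (g z - g x) ∂μ = ∑ z ∈ F, μ.real {z} * (g z - g x) := by
    rw [setIntegral_finset _ hint'.integrableOn, Finset.sum_insert hx]
    simp
  have h3 := integral_add_compl (μ := μ) (s := ↑(insert x F)) (insert x F).measurableSet hint'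
  have h4 : μ.real (↑(insert x F) : Set E)ᶜ = 1 - μ.real {x} - ∑ z ∈ F, μ.real {z} := by
    rw [probReal_compl_eq_one_sub (insert x F).measurableSet, ← sum_measureReal_singleton,
      Finset.sum_insert hx]
    ring
  rw [h1, ← h3, h2, add_sub_cancel_left, ← h4, ← Real.norm_eq_abs]
  refine (norm_setIntegral_le_of_norm_le_const (C := 1) (measure_lt_top _ _) ?_).trans (by simp)
  intro z _
  rw [Real.norm_eq_abs, abs_le]
  constructor <;> linarith [(hg z).1, (hg z).2, (hg x).1, (hg x).2]

variable {q : E → E → ℝ} {C : ℝ} {P : ℝ≥0 → Kernel E E}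

theorem IsTransitionFunction.real_add (hP : IsTransitionFunction q P) (s t : ℝ≥0) (x : E)
    (A : Set E) : (P (s + t) x).real A = ∫ z, (P t z).real A ∂(P s x) := by
  have := hP.isMarkovKernel
  rw [measureReal_def, hP.add, Kernel.comp_apply' _ _ _ (.of_discrete),
    integral_eq_lintegral_of_nonneg_ae (Eventually.of_forall fun _ => measureReal_nonneg)
      (Measurable.of_discrete).aestronglyMeasurable]
  simp

/-- Staying at `x` during both of two time intervals is one way of returning, so `1 - P_t(x,x)` is
subadditive in `t`. A subadditive function lies below the line given by its slope at `0`, which is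
the exit rate. -/
theorem IsTransitionFunction.one_sub_le (hP : IsTransitionFunction q P) (hq : IsBoundedRate q C)
    (t : ℝ≥0) (x : E) : 1 - (P t x).real {x} ≤ C * t := by
  have := hP.isMarkovKernel
  set φ : ℝ≥0 → ℝ := fun t => 1 - (P t x).real {x} with hφ
  have hφ0 : φ 0 = 0 := by
    simp [hφ, hP.zero, measureReal_def, Kernel.id_apply]
  have hsub : ∀ s t, φ (s + t) ≤ φ s + φ t := by
    intro s t
    have h1 := hP.real_add s t x {x}
    have h2 : (P s x).real {x} * (P t x).real {x} ≤ (P (s + t) x).real {x} := by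
      rw [h1]
      have h3 : ∫ z in {x}, (P t z).real {x} ∂(P s x) ≤ ∫ z, (P t z).real {x} ∂(P s x) :=
        setIntegral_le_integral (integrable_of_mem_Icc fun z => hP.real_mem_Icc t z _)
          (Eventually.of_forall fun _ => measureReal_nonneg)
      rwa [integral_singleton, smul_eq_mul] at h3
    have h4 := hP.real_mem_Icc s x {x}
    have h5 := hP.real_mem_Icc t x {x}
    simp only [hφ]
    nlinarith [mul_nonneg (sub_nonneg.2 h4.2) (sub_nonneg.2 h5.2)]
  have hmul : ∀ (m : ℕ) (h : ℝ≥0), φ (m * h) ≤ m * φ h := by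
    intro m h
    induction m with
    | zero => simp [hφ0]
    | succ m ih =>
      have := hsub (m * h) h
      push_cast
      rw [add_mul, one_mul]
      linarith
  rcases eq_or_ne t 0 with rfl | ht
  · rw [NNReal.coe_zero, mul_zero]; exact hφ0.le
  -- Subdivide `[0, t]` into `m + 1` equal pieces and let `m` tend to infinity.
  have hlim : Tendsto (fun m : ℕ => (t : ℝ) * (φ (t / (m + 1 : ℕ)) / ((t / (m + 1 : ℕ) : ℝ≥0) : ℝ)))
      atTop (𝓝 (t * ∑' y : {y : E // y ≠ x}, q x y)) := by
    refine Tendsto.const_mul _ ((hP.exit_rate x).comp ?_)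
    refine tendsto_nhdsWithin_iff.2 ⟨?_, Eventually.of_forall fun m => ?_⟩
    · have := (tendsto_const_div_atTop_nhds_zero_nat (t : ℝ)).comp (tendsto_add_atTop_nat 1)
      rw [← NNReal.tendsto_coe]
      simpa [Function.comp_def] using this
    · exact div_pos (pos_iff_ne_zero.2 ht) (by positivity)
  rw [hq.tsum_ne] at hlim
  have hle : φ t ≤ t * ∑' y, q x y := by
    refine ge_of_tendsto hlim (Eventually.of_forall fun m => ?_)
    have h1 := hmul (m + 1) (t / (m + 1 : ℕ))
    rw [mul_div_cancel₀ _ (by positivity)] at h1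
    refine h1.trans (le_of_eq ?_)
    have : (t : ℝ) ≠ 0 := by exact_mod_cast ht
    push_cast
    field_simp
  calc φ t ≤ t * ∑' y, q x y := hle
    _ ≤ t * C := by gcongr; exact hq.bound x
    _ = C * t := mul_comm _ _

/-- The exit rate equals the sum of the jump rates, so the mass outside `x` and its finitely many
neighbours is `o(h)`; a function with values in `[0, 1]` cannot feel it. -/
theorem IsTransitionFunction.tendsto_generator (hP : IsTransitionFunction q P)
    (hq : IsBoundedRate q C) {g : E → ℝ} (hg : ∀ z, g z ∈ Set.Icc (0 : ℝ) 1) (x : E) :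
    Tendsto (fun h : ℝ≥0 => (∫ z, g z ∂(P h x) - g x) / h) (𝓝[>] 0)
      (𝓝 (∑ z ∈ (hq.finite x).toFinset, q x z * (g z - g x))) := by
  have := hP.isMarkovKernel
  set F := (hq.finite x).toFinset
  have hx : x ∉ F := by simp [F, hq.diag]
  have hF : ∀ z ∈ F, x ≠ z := fun z hz h => hx (h ▸ hz)
  have h1 : Tendsto (fun h : ℝ≥0 => ∑ z ∈ F, (P h x).real {z} / h * (g z - g x)) (𝓝[>] 0)
      (𝓝 (∑ z ∈ F, q x z * (g z - g x))) :=
    tendsto_finsetSum _ fun z hz => (hP.jump_rate x z (hF z hz)).mul_const _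
  have h2 : Tendsto (fun h : ℝ≥0 => (1 - (P h x).real {x}) / h - ∑ z ∈ F, (P h x).real {z} / h)
      (𝓝[>] 0) (𝓝 0) := by
    have h3 := (hP.exit_rate x).sub
      (tendsto_finsetSum F fun z hz => (hP.jump_rate x z (hF z hz)))
    rwa [hq.tsum_ne, hq.tsum_eq, sub_self] at h3
  have h4 : Tendsto (fun h : ℝ≥0 => (∫ z, g z ∂(P h x) - g x) / h -
      ∑ z ∈ F, (P h x).real {z} / h * (g z - g x)) (𝓝[>] 0) (𝓝 0) := by
    refine squeeze_zero_norm (fun h => ?_) h2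
    have h5 := abs_integral_sub_le (P h x) hg x F hx
    rw [Real.norm_eq_abs]
    calc _ = |(∫ z, g z ∂(P h x) - g x - ∑ z ∈ F, (P h x).real {z} * (g z - g x)) / h| := by
          rw [sub_div _ (∑ z ∈ F, _), Finset.sum_div]
          simp only [div_mul_eq_mul_div]
      _ ≤ (1 - (P h x).real {x} - ∑ z ∈ F, (P h x).real {z}) / h := by
          rw [abs_div, NNReal.abs_eq]
          gcongr
      _ = _ := by rw [sub_div, Finset.sum_div]
  simpa using h4.add h1

theorem IsTransitionFunction.abs_sub_le (hP : IsTransitionFunction q P) (hq : IsBoundedRate q C)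
    (s h : ℝ≥0) (x : E) (A : Set E) :
    |(P (s + h) x).real A - (P s x).real A| ≤ C * h := by
  have := hP.isMarkovKernel
  have h1 := abs_integral_sub_le (P h x) (fun z => hP.real_mem_Icc s z A) x ∅ (by simp)
  rw [← hP.real_add, add_comm h s] at h1
  simp only [Finset.sum_empty, sub_zero] at h1
  exact h1.trans (hP.one_sub_le hq h x)

theorem IsTransitionFunction.continuous (hP : IsTransitionFunction q P) (hq : IsBoundedRate q C)
    (x : E) (A : Set E) : Continuous fun s : ℝ => (P s.toNNReal x).real A := by
  have hC : 0 ≤ C := by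
    have := hP.isMarkovKernel
    have := hP.one_sub_le hq 1 x
    have h1 := hP.real_mem_Icc 1 x {x}
    simp only [NNReal.coe_one, mul_one] at this
    linarith [h1.2]
  have hle : ∀ s t : ℝ≥0, s ≤ t → |(P t x).real A - (P s x).real A| ≤ C * dist t s := by
    intro s t hst
    have := hP.abs_sub_le hq s (t - s) x A
    rw [add_tsub_cancel_of_le hst] at this
    rwa [NNReal.dist_eq, ← NNReal.coe_sub hst, NNReal.abs_eq]
  have hlip : LipschitzWith C.toNNReal fun s : ℝ≥0 => (P s x).real A := by
    refine LipschitzWith.of_dist_le_mul fun s t => ?_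
    rw [Real.coe_toNNReal _ hC, Real.dist_eq]
    rcases le_total s t with h | h
    · rw [abs_sub_comm, dist_comm]; exact hle s t h
    · exact hle t s h
  exact hlip.continuous.comp continuous_real_toNNReal

/-- Kolmogorov's backward equation: split the short increment off at the start of the path and apply
the generator to `z ↦ P_s(z, A)`. Only the right derivative is obtained, which suffices for the mean
value inequality because the function is continuous. -/
theorem IsTransitionFunction.hasDerivWithinAt (hP : IsTransitionFunction q P)
    (hq : IsBoundedRate q C) (x : E) (A : Set E) {s : ℝ} (hs : 0 ≤ s) :
    HasDerivWithinAt (fun s : ℝ => (P s.toNNReal x).real A)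
      (∑ z ∈ (hq.finite x).toFinset,
        q x z * ((P s.toNNReal z).real A - (P s.toNNReal x).real A)) (Set.Ici s) s := by
  rw [← hasDerivWithinAt_Ioi_iff_Ici, hasDerivWithinAt_iff_tendsto_slope' (by simp)]
  have h1 := hP.tendsto_generator hq (fun z => hP.real_mem_Icc s.toNNReal z A) x
  have h2 : Tendsto (fun r : ℝ => (r - s).toNNReal) (𝓝[>] s) (𝓝[>] 0) := by
    refine tendsto_nhdsWithin_iff.2 ⟨?_, ?_⟩
    · have : Continuous fun r : ℝ => (r - s).toNNReal := by fun_prop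
      simpa using (this.tendsto s).mono_left nhdsWithin_le_nhds
    · filter_upwards [self_mem_nhdsWithin] with r hr
      simpa using hr
  refine (h1.comp h2).congr' ?_
  filter_upwards [self_mem_nhdsWithin] with r hr
  have hr : s < r := hr
  have h3 : r.toNNReal = (r - s).toNNReal + s.toNNReal := by
    rw [← Real.toNNReal_add (by linarith) hs, sub_add_cancel]
  rw [Function.comp_apply, slope_def_field, Real.coe_toNNReal _ (by linarith), h3, hP.real_add]

/-- Bounded rates determine the transition function. -/
theorem IsTransitionFunction.unique {P' : ℝ≥0 → Kernel E E} (hP : IsTransitionFunction q P)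
    (hP' : IsTransitionFunction q P') (hq : IsBoundedRate q C) : P = P' := by
  have hm := hP.isMarkovKernel
  have hm' := hP'.isMarkovKernel
  rcases isEmpty_or_nonempty E with hE | ⟨⟨x0⟩⟩
  · funext t; exact Kernel.ext fun x => hE.elim x
  have hC : 0 ≤ C := (tsum_nonneg fun y => hq.nonneg x0 y).trans (hq.bound x0)
  -- On `[0, δ]` the integrated backward equation contracts differences by `2Cδ ≤ 1/2`; the `+ 1`
  -- keeps the denominator positive when `C = 0`.
  set δ : ℝ := 1 / (4 * (C + 1)) with hδ
  have hδ0 : 0 < δ := by positivity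
  have hCδ : 2 * C * δ ≤ 1 / 2 := by
    rw [hδ, mul_one_div, div_le_iff₀ (by positivity)]; linarith
  have key : ∀ (k : ℕ) (A : Set E) (x : E) (s : ℝ), s ∈ Set.Icc 0 δ →
      |(P s.toNNReal x).real A - (P' s.toNNReal x).real A| ≤ (1 / 2) ^ k := by
    intro k A
    induction k with
    | zero =>
      intro x s _
      have h1 := hP.real_mem_Icc s.toNNReal x A
      have h2 := hP'.real_mem_Icc s.toNNReal x A
      rw [pow_zero, abs_le]
      constructor <;> linarith [h1.1, h1.2, h2.1, h2.2]
    | succ k ih =>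
      intro x s hs
      have h1 := norm_image_sub_le_of_norm_deriv_right_le_segment (a := 0) (b := δ)
        (C := 2 * C * (1 / 2) ^ k)
        (((hP.continuous hq x A).sub (hP'.continuous hq x A)).continuousOn)
        (fun r hr => (hP.hasDerivWithinAt hq x A hr.1).sub (hP'.hasDerivWithinAt hq x A hr.1))
        (fun r hr => ?_) s hs
      · have h0 : (P 0 x).real A = (P' 0 x).real A := by rw [hP.zero, hP'.zero]
        simp only [Pi.sub_apply, Real.toNNReal_zero, h0, sub_self, sub_zero,
          Real.norm_eq_abs] at h1
        refine h1.trans ?_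
        calc 2 * C * (1 / 2) ^ k * s ≤ 2 * C * (1 / 2) ^ k * δ := by gcongr; exact hs.2
          _ = 2 * C * δ * (1 / 2) ^ k := by ring
          _ ≤ 1 / 2 * (1 / 2) ^ k := by gcongr
          _ = (1 / 2) ^ (k + 1) := by ring
      · rw [← Finset.sum_sub_distrib, Real.norm_eq_abs]
        refine (Finset.abs_sum_le_sum_abs _ _).trans ?_
        have hr' : r ∈ Set.Icc 0 δ := ⟨hr.1, hr.2.le⟩
        calc _ ≤ ∑ z ∈ (hq.finite x).toFinset, q x z * (2 * (1 / 2) ^ k) := by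
              refine Finset.sum_le_sum fun z _ => ?_
              rw [← mul_sub, abs_mul, abs_of_nonneg (hq.nonneg x z)]
              refine mul_le_mul_of_nonneg_left ?_ (hq.nonneg x z)
              have h2 := abs_le.1 (ih z r hr')
              have h3 := abs_le.1 (ih x r hr')
              rw [abs_le]
              constructor <;> linarith [h2.1, h2.2, h3.1, h3.2]
          _ = (∑' z, q x z) * (2 * (1 / 2) ^ k) := by rw [hq.tsum_eq, Finset.sum_mul]
          _ ≤ C * (2 * (1 / 2) ^ k) := by gcongr; exact hq.bound x
          _ = _ := by ring
  have small : ∀ s : ℝ≥0, (s : ℝ) ≤ δ → P s = P' s := by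
    intro s hs
    refine kernel_ext_singleton fun x y => ?_
    have h1 : |(P s x).real {y} - (P' s x).real {y}| ≤ 0 := by
      refine ge_of_tendsto (tendsto_pow_atTop_nhds_zero_of_lt_one (r := (1 / 2 : ℝ))
        (by norm_num) (by norm_num)) (Eventually.of_forall fun k => ?_)
      simpa using key k {y} x s ⟨s.2, hs⟩
    have h2 : (P s x).real {y} = (P' s x).real {y} :=
      sub_eq_zero.1 (abs_eq_zero.1 (le_antisymm h1 (abs_nonneg _)))
    rwa [measureReal_def, measureReal_def,
      ENNReal.toReal_eq_toReal_iff' (measure_ne_top _ _) (measure_ne_top _ _)] at h2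
  -- The semigroup property carries agreement on `[0, δ]` to all times.
  have mult : ∀ (m : ℕ) (s : ℝ≥0), (s : ℝ) ≤ δ → P (m * s) = P' (m * s) := by
    intro m s hs
    induction m with
    | zero => simp [hP.zero, hP'.zero]
    | succ m ih =>
      push_cast
      rw [add_mul, one_mul, hP.add, hP'.add, ih, small s hs]
  funext t
  obtain ⟨m, hm⟩ := exists_nat_gt ((t : ℝ) / δ)
  have hm0 : (0 : ℝ) < m := lt_of_le_of_lt (by positivity) hm
  have h1 := mult m (t / m) (by
    rw [NNReal.coe_div, NNReal.coe_natCast, div_le_iff₀ hm0, mul_comm]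
    exact ((div_lt_iff₀ hδ0).1 hm).le)
  rwa [mul_div_cancel₀ _ (by exact_mod_cast hm0.ne')] at h1

end Markov

/-! ### Invariant laws, reversals and Poisson mixtures of kernels -/

section Kernels

variable {E : Type*} [MeasurableSpace E] [Countable E] [MeasurableSingletonClass E]

theorem comp_singleton (η κ : Kernel E E) (x y : E) :
    (η ∘ₖ κ) x {y} = ∑' z, η z {y} * κ x {z} := by
  rw [Kernel.comp_apply' _ _ _ (.of_discrete), lintegral_countable']

theorem bind_singleton (μ : Measure E) (κ : Kernel E E) (y : E) :
    μ.bind κ {y} = ∑' z, κ z {y} * μ {z} := by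
  rw [Measure.bind_apply (.of_discrete) κ.aemeasurable, lintegral_countable']

theorem tsum_singleton (μ : Measure E) : ∑' x, μ {x} = μ Set.univ := by
  rw [← lintegral_one, lintegral_countable']
  simp

/-- An invariant law of a kernel that charges the state `x₀` from everywhere is unique. -/
theorem invariant_unique {κ : Kernel E E} [IsMarkovKernel κ] {x₀ : E} (hκ : ∀ x, κ x {x₀} ≠ 0)
    {μ ν : Measure E} [IsProbabilityMeasure μ] [IsProbabilityMeasure ν]
    (hμ : Kernel.Invariant κ μ) (hν : Kernel.Invariant κ ν) : μ = ν := by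
  -- The positive part of `μ - ν` is subinvariant. The kernel preserves its finite total mass, so it
  -- is in fact invariant, and if it is nonzero somewhere it is nonzero at `x₀`. This cannot hold
  -- for both `μ - ν` and `ν - μ`.
  have excess : ∀ {μ ν : Measure E} [IsProbabilityMeasure μ] [IsProbabilityMeasure ν],
      Kernel.Invariant κ μ → Kernel.Invariant κ ν → (∃ x, ν {x} < μ {x}) → ν {x₀} < μ {x₀} := by
    intro μ ν _ _ hμ hν ⟨x, hx⟩
    have hmass : ∑' y, ∑' z, κ z {y} * (μ {z} - ν {z}) = ∑' z, (μ {z} - ν {z}) := by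
      rw [ENNReal.tsum_comm]
      simp [ENNReal.tsum_mul_right, tsum_singleton]
    have hle : ∀ y, μ {y} - ν {y} ≤ ∑' z, κ z {y} * (μ {z} - ν {z}) := by
      intro y
      rw [tsub_le_iff_right]
      have h1 : μ {y} = ∑' z, κ z {y} * μ {z} := by
        rw [← bind_singleton, hμ]
      have h2 : ν {y} = ∑' z, κ z {y} * ν {z} := by
        rw [← bind_singleton, hν]
      calc μ {y} = ∑' z, κ z {y} * μ {z} := h1
        _ ≤ ∑' z, (κ z {y} * (μ {z} - ν {z}) + κ z {y} * ν {z}) := by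
          refine ENNReal.tsum_le_tsum fun z => ?_
          rw [← mul_add]
          gcongr
          exact le_tsub_add
        _ = _ := by rw [ENNReal.tsum_add, ← h2]
    have hfin : ∑' y, (μ {y} - ν {y}) ≠ ⊤ := by
      refine ne_top_of_le_ne_top (b := 1) (by simp) ?_
      calc _ ≤ ∑' y, μ {y} := ENNReal.tsum_le_tsum fun y => tsub_le_self
        _ = 1 := by rw [tsum_singleton]; simp
    have heq : μ {x₀} - ν {x₀} = ∑' z, κ z {x₀} * (μ {z} - ν {z}) := by
      refine (hle x₀).antisymm (not_lt.1 fun hlt => ?_)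
      have := ENNReal.tsum_lt_tsum hfin hle hlt
      rw [hmass] at this
      exact lt_irrefl _ this
    rw [← tsub_pos_iff_lt, heq]
    refine lt_of_lt_of_le ?_ (ENNReal.le_tsum x)
    exact pos_iff_ne_zero.2 (mul_ne_zero (hκ x) (tsub_pos_of_lt hx).ne')
  -- Without an excess in one direction one law dominates the other, and equal total masses force
  -- equality.
  have hle_eq : ∀ {μ ν : Measure E} [IsProbabilityMeasure μ] [IsProbabilityMeasure ν],
      (∀ x, μ {x} ≤ ν {x}) → μ = ν := by
    intro μ ν _ _ h
    refine Measure.ext_of_singleton fun y => (h y).antisymm (not_lt.1 fun hlt => ?_)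
    have := ENNReal.tsum_lt_tsum (by rw [tsum_singleton]; simp) h hlt
    rw [tsum_singleton, tsum_singleton, measure_univ, measure_univ] at this
    exact lt_irrefl _ this
  by_cases h1 : ∃ x, ν {x} < μ {x}
  · by_cases h2 : ∃ x, μ {x} < ν {x}
    · exact absurd (excess hμ hν h1) (excess hν hμ h2).not_gt
    · push Not at h2
      exact (hle_eq h2).symm
  · push Not at h1
    exact hle_eq h1

/-- `κ'` is the reversal of `κ` with respect to `μ`, read through the bijection `σ`. -/
def IsReversal (μ : Measure E) (σ : E ≃ E) (κ κ' : Kernel E E) : Prop :=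
  ∀ x y, μ {x} * κ x {y} = μ {y} * κ' (σ y) {σ x}

variable {μ : Measure E} {σ : E ≃ E}

omit [Countable E] in
theorem IsReversal.id : IsReversal μ σ Kernel.id Kernel.id := by
  intro x y
  rw [Kernel.id_apply, Kernel.id_apply, Measure.dirac_apply, Measure.dirac_apply]
  rcases eq_or_ne x y with rfl | h
  · simp
  · simp [h, h.symm]

/-- Reversing a two-step path exchanges the order of the steps; hence the factors of the second
composition appear in the opposite order. The intermediate state is reindexed by `σ`. -/
theorem IsReversal.comp {κ κ' η η' : Kernel E E} (hκ : IsReversal μ σ κ κ')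
    (hη : IsReversal μ σ η η') : IsReversal μ σ (η ∘ₖ κ) (κ' ∘ₖ η') := by
  intro x y
  rw [comp_singleton, comp_singleton, ← ENNReal.tsum_mul_left, ← ENNReal.tsum_mul_left,
    ← σ.tsum_eq fun z => μ {y} * (κ' z {σ x} * η' (σ y) {z})]
  refine tsum_congr fun z => ?_
  rw [mul_left_comm, hκ x z, mul_left_comm, ← mul_assoc, ← mul_assoc, hη z y]
  ring

theorem IsReversal.pow {κ κ' : Kernel E E} (hκ : IsReversal μ σ κ κ') (m : ℕ) :
    IsReversal μ σ (κ ^ m) (κ' ^ m) := by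
  induction m with
  | zero => rw [pow_zero, pow_zero]; exact IsReversal.id
  | succ m ih =>
    rw [pow_succ, pow_succ']
    exact hκ.comp ih

theorem IsReversal.invariant {κ κ' : Kernel E E} [IsMarkovKernel κ'] (hκ : IsReversal μ σ κ κ') :
    Kernel.Invariant κ μ := by
  refine Measure.ext_of_singleton fun y => ?_
  rw [bind_singleton]
  calc ∑' z, κ z {y} * μ {z} = ∑' z, μ {y} * κ' (σ y) {σ z} :=
        tsum_congr fun z => by rw [mul_comm, hκ z y]
    _ = μ {y} := by
      rw [ENNReal.tsum_mul_left, σ.tsum_eq (fun z => κ' (σ y) {z}), tsum_singleton]; simp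

theorem isMarkovKernel_pow {E : Type*} [MeasurableSpace E] (κ : Kernel E E) [IsMarkovKernel κ] (m : ℕ) :
    IsMarkovKernel (κ ^ m) := by
  induction m with
  | zero => rw [pow_zero]; exact inferInstanceAs (IsMarkovKernel Kernel.id)
  | succ m ih => rw [pow_succ]; exact inferInstanceAs (IsMarkovKernel ((κ ^ m) ∘ₖ κ))

/-- The kernel `∑ₘ e^{-r} r^m / m! κ^m`. -/
def poissonize (κ : Kernel E E) (r : ℝ≥0) : Kernel E E where
  toFun x := (poissonMeasure r).bind fun m => (κ ^ m) x
  measurable' := .of_discrete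

theorem poissonize_apply (κ : Kernel E E) (r : ℝ≥0) (x : E) (A : Set E) :
    poissonize κ r x A = ∫⁻ m, (κ ^ m) x A ∂(poissonMeasure r) :=
  Measure.bind_apply (.of_discrete) (Measurable.of_discrete).aemeasurable

theorem poissonize_singleton (κ : Kernel E E) (r : ℝ≥0) (x y : E) :
    poissonize κ r x {y} = ∑' m, (κ ^ m) x {y} * poissonMeasure r {m} := by
  rw [poissonize_apply, lintegral_countable']

instance (κ : Kernel E E) [IsMarkovKernel κ] (r : ℝ≥0) : IsMarkovKernel (poissonize κ r) := by
  refine ⟨fun x => ⟨?_⟩⟩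
  rw [poissonize_apply]
  have := isMarkovKernel_pow κ
  simp

theorem poissonMeasure_zero_singleton (m : ℕ) :
    poissonMeasure 0 {m} = if m = 0 then 1 else 0 := by
  rw [poissonMeasure_singleton]
  cases m <;> simp

theorem poissonize_zero (κ : Kernel E E) : poissonize κ 0 = Kernel.id := by
  refine kernel_ext_singleton fun x y => ?_
  rw [poissonize_singleton]
  simp only [poissonMeasure_zero_singleton, mul_ite, mul_one, mul_zero, tsum_ite_eq, pow_zero]
  rfl

/-- The numbers of steps add: the convolution of two Poisson laws is Poisson, and `κ ^ (m + l)`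
factors through the state after `m` steps. -/
theorem poissonize_add (κ : Kernel E E) (r s : ℝ≥0) :
    poissonize κ (r + s) = poissonize κ s ∘ₖ poissonize κ r := by
  refine Kernel.ext fun x => Measure.ext fun A hA => ?_
  rw [Kernel.comp_apply' _ _ _ hA, poissonize_apply, ← poissonMeasure_conv_poissonMeasure,
    Measure.lintegral_conv (Measurable.of_discrete)]
  simp_rw [poissonize_apply]
  change _ = ∫⁻ z, _ ∂((poissonMeasure r).bind fun m => (κ ^ m) x)
  rw [Measure.lintegral_bind (Measurable.of_discrete).aemeasurable
    (Measurable.of_discrete).aemeasurable]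
  refine lintegral_congr fun m => ?_
  have : ∀ l, (κ ^ (m + l)) x A = ∫⁻ z, (κ ^ l) z A ∂(κ ^ m) x := fun l =>
    Kernel.pow_add_apply_eq_lintegral _ _ _ _ hA
  simp_rw [this, lintegral_countable']
  simp_rw [← ENNReal.tsum_mul_right]
  rw [ENNReal.tsum_comm]
  simp only [mul_right_comm]

theorem IsReversal.poissonize {κ κ' : Kernel E E} (hκ : IsReversal μ σ κ κ') (r : ℝ≥0) :
    IsReversal μ σ (poissonize κ r) (poissonize κ' r) := by
  intro x y
  rw [poissonize_singleton, poissonize_singleton, ← ENNReal.tsum_mul_left,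
    ← ENNReal.tsum_mul_left]
  exact tsum_congr fun m => by rw [← mul_assoc, hκ.pow m x y, mul_assoc]

theorem poissonize_singleton_ne_zero {κ : Kernel E E} {r : ℝ≥0} (hr : 0 < r) {x y : E} {m : ℕ}
    (h : (κ ^ m) x {y} ≠ 0) : poissonize κ r x {y} ≠ 0 := by
  rw [poissonize_singleton]
  refine (lt_of_lt_of_le (pos_iff_ne_zero.2 (mul_ne_zero h ?_)) (ENNReal.le_tsum m)).ne'
  intro h0
  have := poissonMeasure_real_singleton_pos m hr
  simp [measureReal_def, h0] at this

theorem tendsto_nhdsGT_coe {f : ℝ → ℝ} {l : Filter ℝ} (h : Tendsto f (𝓝[>] 0) l) :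
    Tendsto (fun t : ℝ≥0 => f t) (𝓝[>] 0) l := by
  refine h.comp (tendsto_nhdsWithin_iff.2 ⟨?_, ?_⟩)
  · have : Continuous fun t : ℝ≥0 => (t : ℝ) := NNReal.continuous_coe
    simpa using (this.tendsto 0).mono_left nhdsWithin_le_nhds
  · filter_upwards [self_mem_nhdsWithin] with t ht
    exact NNReal.coe_pos.2 ht

theorem poissonize_real (κ : Kernel E E) [IsMarkovKernel κ] (r : ℝ≥0) (x : E) (A : Set E) :
    (poissonize κ r x).real A = ∫ m, ((κ ^ m) x).real A ∂(poissonMeasure r) := by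
  have := isMarkovKernel_pow κ
  rw [measureReal_def, poissonize_apply,
    integral_eq_lintegral_of_nonneg_ae (Eventually.of_forall fun _ => measureReal_nonneg)
      (Measurable.of_discrete).aestronglyMeasurable]
  simp

/-- Differentiation at time `0`. A Poisson variable of mean `C h` equals `0` with probability
`e^{-Ch}` and `1` with probability `C h e^{-Ch}`; the remaining probability is `o(h)`, so only zero
or one step matters. -/
theorem tendsto_poissonize (κ : Kernel E E) [IsMarkovKernel κ] (C : ℝ≥0) (x y : E) :
    Tendsto (fun h : ℝ≥0 => ((poissonize κ (C * h) x).real {y} - ((Kernel.id : Kernel E E) x).real {y}) / (h : ℝ))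
      (𝓝[>] 0) (𝓝 (C * ((κ x).real {y} - ((Kernel.id : Kernel E E) x).real {y}))) := by
  have hM := isMarkovKernel_pow κ
  set g : ℕ → ℝ := fun m => ((κ ^ m) x).real {y} with hg
  have hg0 : g 0 = ((Kernel.id : Kernel E E) x).real {y} := by simp only [hg, pow_zero]; rfl
  have hg1 : g 1 = (κ x).real {y} := by simp [hg]
  have hd : HasDerivAt (fun t : ℝ => Real.exp (-(C * t))) (-C) 0 := by
    have := ((hasDerivAt_id (0 : ℝ)).const_mul (C : ℝ)).neg.exp
    simpa using this
  have he : Tendsto (fun t : ℝ => Real.exp (-(C * t))) (𝓝[>] 0) (𝓝 1) := by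
    have := hd.continuousAt.tendsto.mono_left (nhdsWithin_le_nhds (s := Set.Ioi 0))
    simpa using this
  have hs : Tendsto (fun t : ℝ => (1 - Real.exp (-(C * t))) / t) (𝓝[>] 0) (𝓝 C) := by
    have h1 := (hasDerivWithinAt_iff_tendsto_slope' (by simp)).1 (hd.hasDerivWithinAt (s := Set.Ioi 0))
    have h2 := h1.neg
    rw [neg_neg] at h2
    refine h2.congr fun t => ?_
    rw [slope_def_field, mul_zero, neg_zero, Real.exp_zero, sub_zero, ← neg_div, neg_sub]
  have h1 : Tendsto (fun h : ℝ≥0 => Real.exp (-(C * h)) * C) (𝓝[>] 0) (𝓝 (C : ℝ)) := by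
    have := tendsto_nhdsGT_coe (he.mul_const (C : ℝ))
    rwa [one_mul] at this
  have h2 : Tendsto (fun h : ℝ≥0 => (1 - Real.exp (-(C * h))) / h - Real.exp (-(C * h)) * C)
      (𝓝[>] 0) (𝓝 0) := by
    have := (tendsto_nhdsGT_coe hs).sub h1
    rwa [sub_self] at this
  have h3 : Tendsto (fun h : ℝ≥0 => ((poissonize κ (C * h) x).real {y} - g 0) / (h : ℝ) -
      Real.exp (-(C * h)) * C * (g 1 - g 0)) (𝓝[>] 0) (𝓝 0) := by
    refine squeeze_zero_norm' ?_ h2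
    filter_upwards [self_mem_nhdsWithin] with h hh
    have hh' : (0 : ℝ) < h := NNReal.coe_pos.2 hh
    have h4 := abs_integral_sub_le (poissonMeasure (C * h)) (g := g)
      (fun m => ⟨measureReal_nonneg, measureReal_le_one⟩) 0 {1} (by simp)
    simp only [Finset.sum_singleton, poissonMeasure_real_singleton, pow_zero, pow_one,
      Nat.factorial_zero, Nat.factorial_one, Nat.cast_one, div_one, mul_one,
      NNReal.coe_mul] at h4
    rw [← poissonize_real] at h4
    rw [Real.norm_eq_abs]
    calc _ = |((poissonize κ (C * h) x).real {y} - g 0 -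
          Real.exp (-(C * h)) * (C * h) * (g 1 - g 0)) / h| := by
            congr 1; field_simp
      _ ≤ (1 - Real.exp (-(C * h)) - Real.exp (-(C * h)) * (C * h)) / h := by
          rw [abs_div, NNReal.abs_eq]; gcongr
      _ = _ := by field_simp
  have h5 := h3.add (h1.mul_const (g 1 - g 0))
  rw [hg0, hg1] at h5
  simpa using h5

end Kernels

/-! ### Uniformization: from rates to a jump kernel and a semigroup -/

section Construction

variable {E : Type*} {q : E → E → ℝ} {C : ℝ≥0}

theorem IsBoundedRate.hasSum {C : ℝ} (hq : IsBoundedRate q C) (x : E) :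
    HasSum (q x) (∑' y, q x y) :=
  (summable_of_hasFiniteSupport (hq.finite x)).hasSum

open Classical in
/-- The transition matrix of the chain with rates `q`, uniformized at rate `C`. -/
def jumpMatrix (q : E → E → ℝ) (C : ℝ≥0) (x y : E) : ℝ :=
  q x y / C + if y = x then 1 - (∑' z, q x z) / C else 0

theorem jumpMatrix_nonneg (hq : IsBoundedRate q C) (x y : E) : 0 ≤ jumpMatrix q C x y := by
  refine add_nonneg (div_nonneg (hq.nonneg x y) C.2) ?_
  split_ifs
  · exact sub_nonneg.2 (div_le_one_of_le₀ (hq.bound x) C.2)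
  · rfl

theorem hasSum_jumpMatrix (hq : IsBoundedRate q C) (x : E) : HasSum (jumpMatrix q C x) 1 := by
  classical
  have := ((hq.hasSum x).div_const (C : ℝ)).add (hasSum_ite_eq x (1 - (∑' z, q x z) / C))
  rwa [add_sub_cancel] at this

variable [MeasurableSpace E] [Countable E] [MeasurableSingletonClass E]

/-- The jump kernel of the chain with rates `q`, uniformized at rate `C`. -/
def jumpKernel (q : E → E → ℝ) (C : ℝ≥0) : Kernel E E where
  toFun x := Measure.sum fun y => ENNReal.ofReal (jumpMatrix q C x y) • Measure.dirac y
  measurable' := .of_discrete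

theorem jumpKernel_singleton (x y : E) :
    jumpKernel q C x {y} = ENNReal.ofReal (jumpMatrix q C x y) :=
  Measure.sum_smul_dirac_singleton

theorem isMarkovKernel_jumpKernel (hq : IsBoundedRate q C) : IsMarkovKernel (jumpKernel q C) := by
  refine ⟨fun x => ⟨?_⟩⟩
  rw [← tsum_singleton]
  simp_rw [jumpKernel_singleton]
  rw [← ENNReal.ofReal_tsum_of_nonneg (jumpMatrix_nonneg hq x) (hasSum_jumpMatrix hq x).summable,
    (hasSum_jumpMatrix hq x).tsum_eq, ENNReal.ofReal_one]

theorem jumpKernel_real (hq : IsBoundedRate q C) (x y : E) :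
    (jumpKernel q C x).real {y} = jumpMatrix q C x y := by
  rw [measureReal_def, jumpKernel_singleton, ENNReal.toReal_ofReal (jumpMatrix_nonneg hq x y)]

/-- Bounded rates have a transition function, by uniformization. -/
theorem isTransitionFunction_poissonize (hq : IsBoundedRate q C) (hC : 0 < C) :
    IsTransitionFunction q fun t => poissonize (jumpKernel q C) (C * t) := by
  have := isMarkovKernel_jumpKernel hq
  have hC' : (C : ℝ) ≠ 0 := (NNReal.coe_pos.2 hC).ne'
  refine ⟨fun t => inferInstance, by rw [mul_zero, poissonize_zero],
    fun s t => by rw [mul_add, poissonize_add], fun x y hxy => ?_, fun x => ?_⟩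
  · have h := tendsto_poissonize (jumpKernel q C) C x y
    have h0 : ((Kernel.id : Kernel E E) x).real {y} = 0 := by
      simp [measureReal_def, Kernel.id_apply, hxy]
    rw [h0, jumpKernel_real hq, jumpMatrix, if_neg hxy.symm, add_zero, sub_zero,
      mul_div_cancel₀ _ hC'] at h
    simpa using h
  · have h := (tendsto_poissonize (jumpKernel q C) C x x).neg
    have h0 : ((Kernel.id : Kernel E E) x).real {x} = 1 := by
      simp [measureReal_def, Kernel.id_apply]
    rw [h0, jumpKernel_real hq, jumpMatrix, if_pos rfl, hq.diag] at h
    rw [hq.tsum_ne]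
    convert h using 2
    · rw [← neg_div, neg_sub]
    · field_simp
      ring

/-- Detailed balance of two families of rates with the same exit rates. -/
theorem isReversal_jumpKernel {q' : E → E → ℝ} {μ : Measure E} [IsFiniteMeasure μ] {σ : E ≃ E}
    (hexit : ∀ x, ∑' y, q x y = ∑' y, q' (σ x) y)
    (hbal : ∀ x y, μ.real {x} * q x y = μ.real {y} * q' (σ y) (σ x)) :
    IsReversal μ σ (jumpKernel q C) (jumpKernel q' C) := by
  intro x y
  rw [jumpKernel_singleton, jumpKernel_singleton, ← ofReal_measureReal (μ := μ) (s := {x}),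
    ← ofReal_measureReal (μ := μ) (s := {y}), ← ENNReal.ofReal_mul measureReal_nonneg,
    ← ENNReal.ofReal_mul measureReal_nonneg]
  congr 1
  simp only [jumpMatrix, mul_add, ← mul_div_assoc, hbal x y]
  -- Off the diagonal the balance of the rates is enough; the holding probability on the diagonal is
  -- where the equality of exit rates enters.
  rcases eq_or_ne x y with rfl | h
  · simp [hexit]
  · simp [h, h.symm]

theorem exists_pow_jumpKernel_ne_zero (hq : IsBoundedRate q C) (hC : 0 < C) {x y : E}
    (h : Relation.ReflTransGen (fun a b => 0 < q a b) x y) :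
    ∃ m, (jumpKernel q C ^ m) x {y} ≠ 0 := by
  induction h with
  | refl => exact ⟨0, by rw [pow_zero]; change Kernel.id x {x} ≠ 0; simp [Kernel.id_apply]⟩
  | @tail a b _ hab ih =>
    obtain ⟨m, hm⟩ := ih
    refine ⟨m + 1, ?_⟩
    rw [pow_succ']
    change (jumpKernel q C ∘ₖ (jumpKernel q C ^ m)) x {b} ≠ 0
    rw [comp_singleton]
    refine (lt_of_lt_of_le (pos_iff_ne_zero.2 (mul_ne_zero ?_ hm)) (ENNReal.le_tsum a)).ne'
    rw [jumpKernel_singleton]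
    refine (ENNReal.ofReal_pos.2 (add_pos_of_pos_of_nonneg (by positivity) ?_)).ne'
    split_ifs
    · exact sub_nonneg.2 (div_le_one_of_le₀ (hq.bound a) C.2)
    · rfl

end Construction

/-! ### Finite-dimensional distributions and path laws of reversed stationary chains -/

section PathLaw

theorem iInter_finset_eq_iInter_fin {α : Type*} {I : Finset ℝ} (S : ℝ → Set α) {k : ℕ}
    (hk : I.card = k) : ⋂ r ∈ I, S r = ⋂ i, S (I.orderEmbOfFin hk i) := by
  rw [← Set.biInter_range, Finset.range_orderEmbOfFin]
  simp

/-- Each application of the reversal relation moves `π` one state along the path and turns one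
factor around. -/
theorem IsReversal.prod_eq {E : Type*} [MeasurableSpace E] {π : Measure E} {σ : E ≃ E} {P P' : ℝ≥0 → Kernel E E}
    (h : ∀ t, IsReversal π σ (P t) (P' t)) {k : ℕ} (r : Fin k → ℝ≥0) (x : Fin (k + 1) → E) :
    π {x 0} * ∏ i, P (r i) (x i.castSucc) {x i.succ} =
      π {x (Fin.last k)} * ∏ i, P' (r i) (σ (x i.succ)) {σ (x i.castSucc)} := by
  induction k with
  | zero => simp
  | succ k ih =>
    have h1 := ih (fun i => r i.castSucc) (fun i => x i.castSucc)
    simp only [Fin.castSucc_zero] at h1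
    rw [Fin.prod_univ_castSucc, Fin.prod_univ_castSucc, ← mul_assoc]
    simp only [Fin.succ_castSucc] at h1 ⊢
    rw [h1, mul_right_comm, Fin.succ_last, h _ (x (Fin.last k).castSucc)]
    ring

theorem measurableSet_past {E Ω : Type*} [MeasurableSpace E] [MeasurableSingletonClass E]
    (X : ℝ → Ω → E) {s u : ℝ} (hu : u ≤ s) (x : E) :
    MeasurableSet[⨆ u : Set.Iic s, MeasurableSpace.comap (X u) inferInstance] (X u ⁻¹' {x}) :=
  le_iSup (fun u : Set.Iic s => MeasurableSpace.comap (X u) inferInstance) ⟨u, hu⟩ _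
    ⟨{x}, measurableSet_singleton x, rfl⟩

variable {E : Type*} [MeasurableSpace E] [MeasurableSingletonClass E]

/-- The Markov property of `X` under `μ` with transition function `P`. -/
def HasMarkovProperty (P : ℝ≥0 → Kernel E E) {Ω : Type*} [MeasurableSpace Ω] (μ : Measure Ω)
    (X : ℝ → Ω → E) : Prop :=
  ∀ (s : ℝ) (t : ℝ≥0) (A : Set E), MeasurableSet A →
    μ[(X (s + t) ⁻¹' A).indicator (fun _ => (1 : ℝ)) |
        ⨆ u : Set.Iic s, MeasurableSpace.comap (X u) inferInstance]
      =ᵐ[μ] fun ω => (P t (X s ω)).real A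

variable {Ω : Type*} [MeasurableSpace Ω] {μ : Measure Ω} [IsProbabilityMeasure μ]
  {X : ℝ → Ω → E} {P : ℝ≥0 → Kernel E E}

/-- Integrate the Markov property over the past event `B`, on which the present state is constantly
`x`. -/
theorem HasMarkovProperty.measure_inter (h : HasMarkovProperty P μ X) (hX : ∀ t, Measurable (X t))
    (hP : ∀ t, IsMarkovKernel (P t)) {s : ℝ} {t : ℝ≥0} {B : Set Ω}
    (hB : MeasurableSet[⨆ u : Set.Iic s, MeasurableSpace.comap (X u) inferInstance] B)
    {x : E} (hBx : B ⊆ X s ⁻¹' {x}) (y : E) :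
    μ (B ∩ X (s + t) ⁻¹' {y}) = μ B * P t x {y} := by
  have hm : (⨆ u : Set.Iic s, MeasurableSpace.comap (X u) inferInstance) ≤
      (inferInstance : MeasurableSpace Ω) :=
    iSup_le fun u => (hX u).comap_le
  have hy : MeasurableSet (X (s + t) ⁻¹' {y}) := hX _ (measurableSet_singleton y)
  have h1 := setIntegral_condExp hm (μ := μ)
    (f := (X (s + t) ⁻¹' {y}).indicator (fun _ => (1 : ℝ)))
    ((integrable_const 1).indicator hy) hB
  rw [setIntegral_congr_ae (hm _ hB) ((h s t {y} (measurableSet_singleton y)).mono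
    fun ω hω _ => hω), setIntegral_indicator hy] at h1
  have h2 : ∫ ω in B, (P t (X s ω)).real {y} ∂μ = ∫ ω in B, (P t x).real {y} ∂μ := by
    refine setIntegral_congr_fun (hm _ hB) fun ω hω => ?_
    have : X s ω = x := hBx hω
    simp only [this]
  rw [h2] at h1
  simp only [integral_const, measureReal_restrict_apply_univ, smul_eq_mul, mul_one] at h1
  rw [← ofReal_measureReal (μ := μ), ← h1, ENNReal.ofReal_mul measureReal_nonneg,
    ofReal_measureReal, ofReal_measureReal]

/-- The finite-dimensional distributions of a Markov chain. -/
theorem HasMarkovProperty.measure_iInter (h : HasMarkovProperty P μ X)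
    (hX : ∀ t, Measurable (X t)) (hP : ∀ t, IsMarkovKernel (P t)) {k : ℕ}
    {t : Fin (k + 1) → ℝ} (ht : Monotone t) (x : Fin (k + 1) → E) :
    μ (⋂ i, X (t i) ⁻¹' {x i}) = μ (X (t 0) ⁻¹' {x 0}) *
      ∏ i : Fin k, P (t i.succ - t i.castSucc).toNNReal (x i.castSucc) {x i.succ} := by
  induction k with
  | zero =>
    have : (⋂ i, X (t i) ⁻¹' {x i}) = X (t 0) ⁻¹' {x 0} := by
      ext ω; simp
    simp [this]
  | succ k ih =>
    have h1 : (⋂ i, X (t i) ⁻¹' {x i}) =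
        (⋂ i : Fin (k + 1), X (t i.castSucc) ⁻¹' {x i.castSucc}) ∩
          X (t (Fin.last k).castSucc + (t (Fin.last _) - t (Fin.last k).castSucc).toNNReal) ⁻¹'
            {x (Fin.last _)} := by
      rw [Real.coe_toNNReal _ (sub_nonneg.2 (ht (Fin.le_last _))), add_sub_cancel]
      ext ω
      simp [Fin.forall_fin_succ']
    rw [h1, h.measure_inter hX hP (x := x (Fin.last k).castSucc), ih (t := fun i => t i.castSucc)
      (fun i j hij => ht (Fin.castSucc_le_castSucc_iff.2 hij)) (fun i => x i.castSucc),
      Fin.prod_univ_castSucc]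
    · simp only [Fin.castSucc_zero, Fin.succ_last, mul_assoc, Fin.succ_castSucc]
    · exact MeasurableSet.iInter fun i =>
        measurableSet_past X (ht (Fin.castSucc_le_castSucc_iff.2 (Fin.le_last i))) _
    · exact Set.iInter_subset _ (Fin.last k)

variable [Countable E]

theorem HasMarkovProperty.invariant (h : HasMarkovProperty P μ X) (hX : ∀ t, Measurable (X t))
    (hP : ∀ t, IsMarkovKernel (P t)) (hst : ∀ s t, μ.map (X s) = μ.map (X t)) (s : ℝ) :
    IsInvariantLaw P (μ.map (X s)) := by
  refine ⟨Measure.isProbabilityMeasure_map (hX s).aemeasurable, fun t => ?_⟩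
  refine Measure.ext_of_singleton fun y => ?_
  rw [bind_singleton, hst s (s + t), Measure.map_apply (hX _) (measurableSet_singleton y),
    hst (s + t) s]
  have h1 : X (s + t) ⁻¹' {y} = ⋃ z, X s ⁻¹' {z} ∩ X (s + t) ⁻¹' {y} := by
    ext ω; simp
  rw [h1, measure_iUnion]
  · refine tsum_congr fun z => ?_
    rw [h.measure_inter hX hP (measurableSet_past X le_rfl z) subset_rfl,
      Measure.map_apply (hX _) (measurableSet_singleton z), mul_comm]
  · intro a b hab
    refine Set.disjoint_left.2 fun ω ha hb => hab ?_
    rw [← show X s ω = a from ha.1, ← show X s ω = b from hb.1]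
  · exact fun z => (hX _ (measurableSet_singleton z)).inter (hX _ (measurableSet_singleton y))

/-- A stationary chain and the reversal of a stationary chain with the reversed transition
function have the same finite-dimensional distributions. -/
theorem HasMarkovProperty.measure_iInter_reversal {Ω' : Type*} [MeasurableSpace Ω']
    {μ' : Measure Ω'} [IsProbabilityMeasure μ'] {X' : ℝ → Ω' → E} {P' : ℝ≥0 → Kernel E E}
    {π : Measure E} {σ : E ≃ E} (h : HasMarkovProperty P μ X) (h' : HasMarkovProperty P' μ' X')
    (hX : ∀ t, Measurable (X t)) (hX' : ∀ t, Measurable (X' t))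
    (hP : ∀ t, IsMarkovKernel (P t)) (hP' : ∀ t, IsMarkovKernel (P' t))
    (hπ : ∀ t, μ.map (X t) = π) (hπ' : ∀ t, (μ'.map (X' t)).map σ.symm = π)
    (hrev : ∀ t, IsReversal π σ (P t) (P' t)) (I : Finset ℝ) (z : ℝ → E) :
    μ (⋂ t ∈ I, X t ⁻¹' {z t}) = μ' (⋂ t ∈ I, X' (-t) ⁻¹' {σ (z t)}) := by
  rcases hc : I.card with _ | k
  · rw [Finset.card_eq_zero] at hc
    subst hc
    simp
  set t := I.orderEmbOfFin hc
  -- Negation makes the times decreasing; reversing the indices makes them increasing again, as the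
  -- Markov formula requires.
  have hrevI : ∀ (S : Fin (k + 1) → Set Ω'), ⋂ i, S i = ⋂ i, S (Fin.rev i) := by
    intro S
    exact (Fin.revPerm.surjective.iInter_comp S).symm
  rw [iInter_finset_eq_iInter_fin _ hc, iInter_finset_eq_iInter_fin _ hc, hrevI, h.measure_iInter hX hP t.monotone,
    h'.measure_iInter hX' hP' (t := fun i => -t (Fin.rev i))
      (fun i j hij => neg_le_neg (t.monotone (Fin.rev_le_rev.2 hij)))
      (fun i => σ (z (t (Fin.rev i))))]
  have h0 : ∀ r x, μ (X r ⁻¹' {x}) = π {x} := fun r x => by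
    rw [← hπ r, Measure.map_apply (hX r) (measurableSet_singleton x)]
  have h0' : ∀ r x, μ' (X' r ⁻¹' {σ x}) = π {x} := fun r x => by
    rw [← hπ' r, Measure.map_apply (Measurable.of_discrete) (measurableSet_singleton x),
      Measure.map_apply (hX' r) (.of_discrete)]
    congr 1
    ext ω
    simp [Equiv.symm_apply_eq]
  rw [h0, h0', IsReversal.prod_eq hrev (fun i => (t i.succ - t i.castSucc).toNNReal)
    (fun i => z (t i)), Fin.rev_zero]
  congr 1
  rw [← Equiv.prod_comp Fin.revPerm]
  refine Finset.prod_congr rfl fun i _ => ?_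
  simp only [Fin.revPerm_apply, Fin.rev_castSucc, Fin.rev_succ, neg_sub_neg]

/-- A law on path space is determined by its finite-dimensional marginals, and these, living on
countable discrete spaces, by their values on singletons. -/
theorem HasMarkovProperty.map_path_eq {Ω' : Type*} [MeasurableSpace Ω']
    {μ' : Measure Ω'} [IsProbabilityMeasure μ'] {X' : ℝ → Ω' → E} {P' : ℝ≥0 → Kernel E E}
    {π : Measure E} {σ : E ≃ E} (h : HasMarkovProperty P μ X) (h' : HasMarkovProperty P' μ' X')
    (hX : ∀ t, Measurable (X t)) (hX' : ∀ t, Measurable (X' t))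
    (hP : ∀ t, IsMarkovKernel (P t)) (hP' : ∀ t, IsMarkovKernel (P' t))
    (hπ : ∀ t, μ.map (X t) = π) (hπ' : ∀ t, (μ'.map (X' t)).map σ.symm = π)
    (hrev : ∀ t, IsReversal π σ (P t) (P' t)) :
    μ.map (fun ω t => X t ω) = μ'.map (fun ω t => σ.symm (X' (-t) ω)) := by
  have hY' : ∀ t, Measurable fun ω => σ.symm (X' (-t) ω) := fun t =>
    Measurable.of_discrete.comp (hX' _)
  have hm := isProjectiveLimit_map (P := μ) (X := X) (measurable_pi_lambda _ hX).aemeasurable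
  have hm' := isProjectiveLimit_map (P := μ') (X := fun t ω => σ.symm (X' (-t) ω))
    (measurable_pi_lambda _ hY').aemeasurable
  refine hm.unique ?_
  convert hm' using 2 with I
  refine Measure.ext_of_singleton fun z => ?_
  have hE : Nonempty E := ⟨X 0 (Classical.choice (nonempty_of_isProbabilityMeasure μ))⟩
  classical
  -- The values of `z'` off `I` play no role; it only puts `z` in the form used for the
  -- finite-dimensional formula.
  set z' : ℝ → E := fun t => if ht : t ∈ I then z ⟨t, ht⟩ else Classical.choice hE
  have hz' : ∀ t (ht : t ∈ I), z' t = z ⟨t, ht⟩ := fun t ht => dif_pos ht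
  have key := h.measure_iInter_reversal h' hX hX' hP hP' hπ hπ' hrev I z'
  have mI : Measurable fun ω => I.restrict (X · ω) :=
    measurable_pi_lambda _ fun t => hX t
  have mI' : Measurable fun ω => I.restrict (fun t => σ.symm (X' (-t) ω)) :=
    measurable_pi_lambda _ fun t => hY' t
  rw [Measure.map_apply mI (measurableSet_singleton z),
    Measure.map_apply mI' (measurableSet_singleton z)]
  convert key using 2
  · ext ω
    simp only [Set.mem_preimage, Set.mem_singleton_iff, funext_iff, Set.mem_iInter,
      Finset.restrict_def, Subtype.forall]
    exact forall₂_congr fun t ht => by rw [hz' t ht]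
  · ext ω
    simp only [Set.mem_preimage, Set.mem_singleton_iff, funext_iff, Set.mem_iInter,
      Finset.restrict_def, Subtype.forall]
    exact forall₂_congr fun t ht => by rw [hz' t ht, Equiv.symm_apply_eq]

end PathLaw

/-! ### Combinatorics of the jumps, exit rates and reachability of the empty array -/

section Arrays

variable {n : ℕ}

theorem mem_triangle {i j : ℕ} : (i, j) ∈ triangle n ↔ 1 ≤ i ∧ 1 ≤ j ∧ i + j ≤ n + 1 := by
  simp only [triangle, Finset.mem_filter, Finset.mem_product, Finset.mem_Icc]
  omega

theorem coord_of_mem (x : State n) {i j : ℕ} (h : (i, j) ∈ triangle n) :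
    coord x i j = x.1 ⟨(i, j), h⟩ := dif_pos h

theorem coord_site (x : State n) (s : Site n) : coord x s.1.1 s.1.2 = x.1 s := dif_pos s.2

/-- The default value `0` beyond the antidiagonal acts as the wall: a left jump of a boundary
particle is blocked exactly when that particle is at `0`. -/
theorem coord_of_notMem (x : State n) {i j : ℕ} (h : (i, j) ∉ triangle n) : coord x i j = 0 :=
  dif_neg h

theorem coord_succ_left (x : State n) {i : ℕ} (hi : 1 ≤ i) (j : ℕ) :
    coord x (i + 1) j ≤ coord x i j := by
  by_cases h : (i + 1, j) ∈ triangle n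
  · have h' : (i, j) ∈ triangle n := by rw [mem_triangle] at h ⊢; omega
    rw [coord_of_mem x h, coord_of_mem x h']
    exact x.2 _ _ (Or.inl rfl)
  · simp [coord_of_notMem x h]

theorem coord_succ_right (x : State n) (i : ℕ) {j : ℕ} (hj : 1 ≤ j) :
    coord x i (j + 1) ≤ coord x i j := by
  by_cases h : (i, j + 1) ∈ triangle n
  · have h' : (i, j) ∈ triangle n := by rw [mem_triangle] at h ⊢; omega
    rw [coord_of_mem x h, coord_of_mem x h']
    exact x.2 _ _ (Or.inr rfl)
  · simp [coord_of_notMem x h]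

theorem coord_anti_left (x : State n) {i i' : ℕ} (hi : 1 ≤ i) (h : i ≤ i') (j : ℕ) :
    coord x i' j ≤ coord x i j := by
  induction i', h using Nat.le_induction with
  | base => rfl
  | succ m hm ih => exact (coord_succ_left x (hi.trans hm) j).trans ih

theorem coord_anti_right (x : State n) (i : ℕ) {j j' : ℕ} (hj : 1 ≤ j) (h : j ≤ j') :
    coord x i j' ≤ coord x i j := by
  induction j', h using Nat.le_induction with
  | base => rfl
  | succ m hm ih => exact (coord_succ_right x i (hj.trans hm)).trans ih

theorem state_ext {x y : State n} (h : ∀ i j, (i, j) ∈ triangle n → coord x i j = coord y i j) :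
    x = y := by
  refine Subtype.ext (funext fun s => ?_)
  rw [← coord_site, ← coord_site]
  exact h _ _ s.2

theorem exists_state (f : ℕ → ℕ → ℕ)
    (h1 : ∀ i j, (i + 1, j) ∈ triangle n → 1 ≤ i → f (i + 1) j ≤ f i j)
    (h2 : ∀ i j, (i, j + 1) ∈ triangle n → 1 ≤ j → f i (j + 1) ≤ f i j) :
    ∃ x : State n, ∀ i j, (i, j) ∈ triangle n → coord x i j = f i j := by
  refine ⟨⟨fun s => f s.1.1 s.1.2, ?_⟩, fun i j h => by rw [coord_of_mem _ h]⟩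
  rintro ⟨⟨i, j⟩, hs⟩ ⟨⟨i', j'⟩, ht⟩ h
  rw [mem_triangle] at hs
  rcases h with h | h <;> obtain ⟨rfl, rfl⟩ := Prod.mk.inj h
  · exact h1 _ _ ht hs.1
  · exact h2 _ _ ht hs.2.1

/-- The transposition of arrays. -/
def transpose (n : ℕ) : State n ≃ State n where
  toFun x := ⟨fun s => x.1 s.swap, fun s t h => x.2 _ _ (by
    rcases h with h | h
    · exact Or.inr (by simp [Site.swap, h])
    · exact Or.inl (by simp [Site.swap, h]))⟩
  invFun x := ⟨fun s => x.1 s.swap, fun s t h => x.2 _ _ (by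
    rcases h with h | h
    · exact Or.inr (by simp [Site.swap, h])
    · exact Or.inl (by simp [Site.swap, h]))⟩
  left_inv _ := rfl
  right_inv _ := rfl

theorem transpose_transpose (x : State n) : transpose n (transpose n x) = x := rfl

theorem coord_transpose (x : State n) (i j : ℕ) : coord (transpose n x) i j = coord x j i := by
  by_cases h : (i, j) ∈ triangle n
  · have h' : (j, i) ∈ triangle n := by rw [mem_triangle] at h ⊢; omega
    rw [coord_of_mem _ h, coord_of_mem _ h']
    rfl
  · have h' : (j, i) ∉ triangle n := by rw [mem_triangle] at h ⊢; omega
    rw [coord_of_notMem _ h, coord_of_notMem _ h']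

/-! ### Jumps -/

theorem isRightJump_iff {x y : State n} {i j k : ℕ} (hij : (i, j) ∈ triangle n) (hk : 1 ≤ k) :
    IsRightJump x y i j k ↔
      (∀ a b, coord y a b = coord x a b + if a = i ∧ k ≤ b ∧ b ≤ j then 1 else 0) ∧
        ∀ p, k ≤ p → p ≤ j → coord x i p = coord x i j := by
  rw [mem_triangle] at hij
  refine and_congr ⟨fun h a b => ?_, fun h s => ?_⟩ ?_
  · by_cases hab : (a, b) ∈ triangle n
    · rw [coord_of_mem _ hab, coord_of_mem _ hab]
      exact h _
    · rw [coord_of_notMem _ hab, coord_of_notMem _ hab, if_neg]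
      rw [mem_triangle] at hab
      omega
  · rw [← coord_site, ← coord_site]
    exact h _ _
  · simp only [Finset.mem_Icc, and_imp]

theorem isLeftJump_iff {x y : State n} {i j l : ℕ} (hi : 1 ≤ i) (hj : 1 ≤ j)
    (hl : l ≤ n + 1 - j) :
    IsLeftJump x y i j l ↔
      (∀ a b, coord x a b = coord y a b + if b = j ∧ i ≤ a ∧ a ≤ l then 1 else 0) ∧
        ∀ p, i ≤ p → p ≤ l → coord x p j = coord x i j := by
  refine and_congr ⟨fun h a b => ?_, fun h s => ?_⟩ ?_
  · by_cases hab : (a, b) ∈ triangle n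
    · rw [coord_of_mem _ hab, coord_of_mem _ hab]
      exact h _
    · rw [coord_of_notMem _ hab, coord_of_notMem _ hab, if_neg]
      rw [mem_triangle] at hab
      omega
  · rw [← coord_site, ← coord_site]
    exact h _ _
  · simp only [Finset.mem_Icc, and_imp]

/-- The reversal of a right jump is, after transposition, a left jump. -/
theorem isLeftJump_transpose_iff {x y : State n} {i j k : ℕ} (hij : (i, j) ∈ triangle n)
    (hk : 1 ≤ k) (hkj : k ≤ j) :
    IsLeftJump (transpose n y) (transpose n x) k i j ↔ IsRightJump x y i j k := by
  have hij' := mem_triangle.1 hij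
  rw [isLeftJump_iff hk hij'.1 (by omega), isRightJump_iff hij hk]
  simp only [coord_transpose]
  rw [forall_comm (α := ℕ) (β := ℕ)]
  refine and_congr_right fun h => ?_
  have hy : ∀ p, k ≤ p → p ≤ j → coord y i p = coord x i p + 1 := fun p h1 h2 => by
    rw [h i p, if_pos ⟨rfl, h1, h2⟩]
  constructor
  · intro hp p h1 h2
    have e1 := hp p h1 h2
    have e2 := hp j hkj le_rfl
    rw [hy k le_rfl hkj] at e1 e2
    rw [hy p h1 h2] at e1
    rw [hy j hkj le_rfl] at e2
    omega
  · intro hp p h1 h2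
    rw [hy p h1 h2, hy k le_rfl hkj, hp p h1 h2, hp k le_rfl hkj]

/-- A right jump of the particle at `(i, j)` is possible unless it is blocked by `(i - 1, j)`, and
then determines the configuration after the jump. -/
theorem exists_isRightJump_iff (x : State n) {i j : ℕ} (hij : (i, j) ∈ triangle n)
    (h : i = 1 ∨ coord x i j < coord x (i - 1) j) :
    ∃ k₀ ∈ Finset.Icc 1 j, ∃ y₀, ∀ k ∈ Finset.Icc 1 j, ∀ y,
      IsRightJump x y i j k ↔ k = k₀ ∧ y = y₀ := by
  have hij' := mem_triangle.1 hij
  classical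
  have hex : ∃ k, 1 ≤ k ∧ coord x i k = coord x i j := ⟨j, hij'.2.1, rfl⟩
  -- The left end of the block of entries of row `i` equal to `x_{ij}`. Starting the jump further
  -- right would break the monotonicity of the row, further left the equality condition.
  set k₀ := Nat.find hex with hk₀
  have hk1 : 1 ≤ k₀ := (Nat.find_spec hex).1
  have hkeq : coord x i k₀ = coord x i j := (Nat.find_spec hex).2
  have hkj : k₀ ≤ j := Nat.find_min' hex ⟨hij'.2.1, rfl⟩
  have hrun : ∀ p, k₀ ≤ p → p ≤ j → coord x i p = coord x i j := fun p h1 h2 =>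
    (hkeq ▸ coord_anti_right x i hk1 h1).antisymm (coord_anti_right x i (hk1.trans h1) h2)
  obtain ⟨y₀, hy₀⟩ := exists_state (n := n)
    (fun a b => coord x a b + if a = i ∧ k₀ ≤ b ∧ b ≤ j then 1 else 0)
    (fun a b hab ha => by
      have h1 := coord_succ_left x ha b
      split_ifs with h2 h3 h3 <;> try omega
      obtain ⟨rfl, h2, h2'⟩ := h2
      have h4 : coord x (a + 1) j < coord x a j := by
        rcases h with h | h
        · omega
        · simpa using h
      have h5 := coord_anti_right x a (hk1.trans h2) h2'
      have h6 := hrun b h2 h2'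
      omega)
    (fun a b hab hb => by
      have h1 := coord_succ_right x a hb
      split_ifs with h2 h3 h3 <;> try omega
      obtain ⟨rfl, h2, h2'⟩ := h2
      have h4 : b + 1 = k₀ := by omega
      have h5 : coord x a b ≠ coord x a j := fun h5 =>
        Nat.find_min hex (m := b) (by omega) ⟨hb, h5⟩
      have h6 := coord_anti_right x a hb (show b ≤ j by omega)
      rw [h4, hkeq]
      omega)
  have hy₀' : ∀ a b, coord y₀ a b = coord x a b + if a = i ∧ k₀ ≤ b ∧ b ≤ j then 1 else 0 := by
    intro a b
    by_cases hab : (a, b) ∈ triangle n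
    · exact hy₀ a b hab
    · rw [coord_of_notMem _ hab, coord_of_notMem _ hab, if_neg]
      rw [mem_triangle] at hab
      omega
  refine ⟨k₀, Finset.mem_Icc.2 ⟨hk1, hkj⟩, y₀, fun k hk y => ⟨fun hjump => ?_, ?_⟩⟩
  · rw [Finset.mem_Icc] at hk
    rw [isRightJump_iff hij hk.1] at hjump
    have h1 : k₀ ≤ k := Nat.find_min' hex ⟨hk.1, hjump.2 k le_rfl hk.2⟩
    have h2 : k = k₀ := by
      by_contra hne
      have h3 := hjump.1 i (k - 1)
      have h4 := hjump.1 i k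
      rw [if_neg (by omega)] at h3
      rw [if_pos ⟨rfl, le_rfl, hk.2⟩] at h4
      have h5 := hrun (k - 1) (by omega) (by omega)
      have h6 := hrun k h1 hk.2
      have h7 := coord_succ_right y i (j := k - 1) (by omega)
      rw [Nat.sub_add_cancel hk.1] at h7
      omega
    refine ⟨h2, state_ext fun a b _ => ?_⟩
    rw [hjump.1, hy₀', h2]
  · rintro ⟨rfl, rfl⟩
    exact (isRightJump_iff hij hk1).2 ⟨hy₀', hrun⟩

theorem not_isRightJump {x y : State n} {i j k : ℕ} (hij : (i, j) ∈ triangle n)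
    (h : ¬(i = 1 ∨ coord x i j < coord x (i - 1) j)) (hk : k ∈ Finset.Icc 1 j) :
    ¬IsRightJump x y i j k := by
  have hij' := mem_triangle.1 hij
  rw [Finset.mem_Icc] at hk
  rw [isRightJump_iff hij hk.1]
  rintro ⟨h1, -⟩
  have h2 := h1 i j
  have h3 := h1 (i - 1) j
  rw [if_pos ⟨rfl, hk.2, le_rfl⟩] at h2
  rw [if_neg (by omega)] at h3
  have h4 := coord_succ_left y (i := i - 1) (by omega) j
  rw [Nat.sub_add_cancel hij'.1] at h4
  omega

/-- A left jump of the particle at `(i, j)` is possible unless it is blocked by `(i, j + 1)`, and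
then determines the configuration after the jump. -/
theorem exists_isLeftJump_iff (x : State n) {i j : ℕ} (hij : (i, j) ∈ triangle n)
    (h : coord x i (j + 1) < coord x i j) :
    ∃ l₀ ∈ Finset.Icc i (n + 1 - j), ∃ y₀, ∀ l ∈ Finset.Icc i (n + 1 - j), ∀ y,
      IsLeftJump x y i j l ↔ l = l₀ ∧ y = y₀ := by
  have hij' := mem_triangle.1 hij
  classical
  -- The far end of the block of entries of column `j` equal to `x_{ij}`; a shorter jump would break
  -- the monotonicity of the column.
  set l₀ := Nat.findGreatest (fun l => i ≤ l ∧ coord x l j = coord x i j) (n + 1 - j)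
  have hin : i ≤ n + 1 - j := by omega
  have hspec : i ≤ l₀ ∧ coord x l₀ j = coord x i j :=
    Nat.findGreatest_spec (P := fun l => i ≤ l ∧ coord x l j = coord x i j) hin ⟨le_rfl, rfl⟩
  have hln : l₀ ≤ n + 1 - j := Nat.findGreatest_le _
  have hmax : ∀ l, i ≤ l → l ≤ n + 1 - j → coord x l j = coord x i j → l ≤ l₀ := fun l h1 h2 h3 =>
    Nat.le_findGreatest h2 ⟨h1, h3⟩
  have hrun : ∀ p, i ≤ p → p ≤ l₀ → coord x p j = coord x i j := fun p h1 h2 =>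
    (coord_anti_left x hij'.1 h1 j).antisymm
      (hspec.2 ▸ coord_anti_left x (hij'.1.trans h1) h2 j)
  obtain ⟨y₀, hy₀⟩ := exists_state (n := n)
    (fun a b => coord x a b - if b = j ∧ i ≤ a ∧ a ≤ l₀ then 1 else 0)
    (fun a b hab ha => by
      have h1 := coord_succ_left x ha b
      split_ifs with h2 h3 h3 <;> try omega
      obtain ⟨rfl, h3, h3'⟩ := h3
      have h4 : coord x (a + 1) b ≠ coord x i b := fun h4 => by
        have := hmax (a + 1) (by omega) (by rw [mem_triangle] at hab; omega) h4
        omega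
      have h5 := hrun a h3 h3'
      omega)
    (fun a b hab hb => by
      have h1 := coord_succ_right x a hb
      split_ifs with h2 h3 h3 <;> try omega
      obtain ⟨rfl, h3, h3'⟩ := h3
      have h4 := coord_anti_left x hij'.1 h3 (b + 1)
      have h5 := hrun a h3 h3'
      omega)
  have hpos : ∀ p, i ≤ p → p ≤ l₀ → 1 ≤ coord x p j := fun p h1 h2 => by
    rw [hrun p h1 h2]; omega
  have hy₀' : ∀ a b, coord x a b = coord y₀ a b + if b = j ∧ i ≤ a ∧ a ≤ l₀ then 1 else 0 := by
    intro a b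
    by_cases hab : (a, b) ∈ triangle n
    · rw [hy₀ a b hab]
      split_ifs with h1
      · obtain ⟨rfl, h1, h2⟩ := h1
        have := hpos a h1 h2
        omega
      · rfl
    · rw [coord_of_notMem _ hab, coord_of_notMem _ hab, if_neg]
      rw [mem_triangle] at hab
      omega
  refine ⟨l₀, Finset.mem_Icc.2 ⟨hspec.1, hln⟩, y₀, fun l hl y => ⟨fun hjump => ?_, ?_⟩⟩
  · rw [Finset.mem_Icc] at hl
    rw [isLeftJump_iff hij'.1 hij'.2.1 hl.2] at hjump
    have h1 : l ≤ l₀ := hmax l hl.1 hl.2 (hjump.2 l hl.1 le_rfl)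
    have h2 : l = l₀ := by
      by_contra hne
      have h3 := hjump.1 (l + 1) j
      have h4 := hjump.1 l j
      rw [if_neg (by omega)] at h3
      rw [if_pos ⟨rfl, hl.1, le_rfl⟩] at h4
      have h5 := hrun (l + 1) (by omega) (by omega)
      have h6 := hrun l hl.1 h1
      have h7 := coord_succ_left y (i := l) (by omega) j
      omega
    refine ⟨h2, state_ext fun a b _ => ?_⟩
    have h3 := hjump.1 a b
    have h4 := hy₀' a b
    rw [h2] at h3
    omega
  · rintro ⟨rfl, rfl⟩
    exact (isLeftJump_iff hij'.1 hij'.2.1 hln).2 ⟨hy₀', hrun⟩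

theorem not_isLeftJump {x y : State n} {i j l : ℕ} (hij : (i, j) ∈ triangle n)
    (h : ¬coord x i (j + 1) < coord x i j) (hl : l ∈ Finset.Icc i (n + 1 - j)) :
    ¬IsLeftJump x y i j l := by
  have hij' := mem_triangle.1 hij
  rw [Finset.mem_Icc] at hl
  rw [isLeftJump_iff hij'.1 hij'.2.1 hl.2]
  rintro ⟨h1, -⟩
  have h2 := h1 i j
  have h3 := h1 i (j + 1)
  rw [if_pos ⟨rfl, le_rfl, hl.1⟩] at h2
  rw [if_neg (by omega)] at h3
  have h4 := coord_succ_right y i hij'.2.1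
  omega

/-! ### Rates -/

theorem modulator_le_iff (x : State n) (i j : ℕ) :
    modulator x i j ≤ (coord x i j : ℕ∞) ↔ i ≠ 1 ∧ coord x (i - 1) (j + 1) ≤ coord x i j := by
  unfold modulator
  split_ifs with h
  · simp [h]
  · simp [h]

theorem modulator_lt_iff (x : State n) (i j : ℕ) :
    modulator x i j < (coord x i j : ℕ∞) ↔ i ≠ 1 ∧ coord x (i - 1) (j + 1) < coord x i j := by
  unfold modulator
  split_ifs with h
  · simp [h]
  · simp [h]

/-- The rate of the right jumps of the particle at `(i, j)`. -/
def rightRate (n : ℕ) (v : ℕ → ℝ) (x : State n) (i j : ℕ) : ℝ :=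
  v (n - j + 1) *
    (if i ≠ 1 ∧ coord x (i - 1) (j + 1) ≤ coord x i j then (v (n - j + 1) * v (i - 1))⁻¹ else 1)

/-- The rate of the left jumps of the particle at `(i, j)`. -/
def leftRate (n : ℕ) (v : ℕ → ℝ) (x : State n) (i j : ℕ) : ℝ :=
  (v (n - j + 1))⁻¹ *
    (if i ≠ 1 ∧ coord x (i - 1) (j + 1) < coord x i j then v (i - 1) * v (n - j + 1) else 1)

open Classical in
/-- The part of the rates coming from right jumps. -/
def rightPart (n : ℕ) (v : ℕ → ℝ) (x y : State n) : ℝ :=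
  ∑ s ∈ triangle n, ∑ k ∈ Finset.Icc 1 s.2,
    if IsRightJump x y s.1 s.2 k then rightRate n v x s.1 s.2 else 0

open Classical in
/-- The part of the rates coming from left jumps. -/
def leftPart (n : ℕ) (v : ℕ → ℝ) (x y : State n) : ℝ :=
  ∑ s ∈ triangle n, ∑ l ∈ Finset.Icc s.1 (n + 1 - s.2),
    if IsLeftJump x y s.1 s.2 l then leftRate n v x s.1 s.2 else 0

theorem rate_eq (v : ℕ → ℝ) (x y : State n) :
    rate n v x y = rightPart n v x y + leftPart n v x y := by
  simp only [rate, rightPart, leftPart, rightRate, leftRate, modulator_le_iff, modulator_lt_iff]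

/-- The total rate of leaving `x`. -/
def exitRate (n : ℕ) (v : ℕ → ℝ) (x : State n) : ℝ :=
  ∑ s ∈ triangle n,
    ((if s.1 = 1 ∨ coord x s.1 s.2 < coord x (s.1 - 1) s.2 then rightRate n v x s.1 s.2 else 0) +
      if coord x s.1 (s.2 + 1) < coord x s.1 s.2 then leftRate n v x s.1 s.2 else 0)

/-- Each particle has exactly one target for its right jump unless blocked, and likewise for its
left jump, so summing over targets leaves one rate per unblocked move. -/
theorem hasSum_rate (v : ℕ → ℝ) (x : State n) : HasSum (rate n v x) (exitRate n v x) := by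
  classical
  have h0 : rate n v x = fun y => ∑ s ∈ triangle n,
      ((∑ k ∈ Finset.Icc 1 s.2,
        if IsRightJump x y s.1 s.2 k then rightRate n v x s.1 s.2 else 0) +
      ∑ l ∈ Finset.Icc s.1 (n + 1 - s.2),
        if IsLeftJump x y s.1 s.2 l then leftRate n v x s.1 s.2 else 0) := by
    funext y
    rw [rate_eq, rightPart, leftPart, Finset.sum_add_distrib]
  rw [h0]
  refine hasSum_sum fun s hs => HasSum.add ?_ ?_
  · split_ifs with h
    · obtain ⟨k₀, hk₀, y₀, hy₀⟩ := exists_isRightJump_iff x (i := s.1) (j := s.2) hs h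
      convert hasSum_ite_eq y₀ (rightRate n v x s.1 s.2) using 2 with y
      rw [Finset.sum_congr rfl fun k hk => if_congr (hy₀ k hk y) rfl rfl]
      simp only [ite_and, Finset.sum_ite_eq', hk₀, if_true]
    · convert hasSum_zero (α := ℝ) (β := State n) using 2 with y
      exact Finset.sum_eq_zero fun k hk => if_neg (not_isRightJump hs h hk)
  · split_ifs with h
    · obtain ⟨l₀, hl₀, y₀, hy₀⟩ := exists_isLeftJump_iff x (i := s.1) (j := s.2) hs h
      convert hasSum_ite_eq y₀ (leftRate n v x s.1 s.2) using 2 with y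
      rw [Finset.sum_congr rfl fun k hk => if_congr (hy₀ k hk y) rfl rfl]
      simp only [ite_and, Finset.sum_ite_eq', hl₀, if_true]
    · convert hasSum_zero (α := ℝ) (β := State n) using 2 with y
      exact Finset.sum_eq_zero fun k hk => if_neg (not_isLeftJump hs h hk)

theorem finite_support_rate (v : ℕ → ℝ) (x : State n) : (Function.support (rate n v x)).Finite := by
  classical
  have hfin : ((⋃ s ∈ triangle n, ⋃ k ∈ Finset.Icc 1 s.2, {y | IsRightJump x y s.1 s.2 k}) ∪
      ⋃ s ∈ triangle n, ⋃ l ∈ Finset.Icc s.1 (n + 1 - s.2),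
        {y | IsLeftJump x y s.1 s.2 l}).Finite := by
    refine Set.Finite.union ?_ ?_
    · refine (triangle n).finite_toSet.biUnion fun s _ =>
        (Finset.Icc 1 s.2).finite_toSet.biUnion fun k _ => Set.Subsingleton.finite ?_
      intro y hy z hz
      exact Subtype.ext (funext fun r => by rw [hy.1 r, hz.1 r])
    · refine (triangle n).finite_toSet.biUnion fun s _ =>
        (Finset.Icc s.1 (n + 1 - s.2)).finite_toSet.biUnion fun k _ => Set.Subsingleton.finite ?_
      intro y hy z hz
      refine Subtype.ext (funext fun r => ?_)
      have h1 := hy.1 r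
      have h2 := hz.1 r
      omega
  refine hfin.subset fun y hy => ?_
  by_contra hn
  simp only [Set.mem_union, Set.mem_iUnion, Set.mem_ofPred_eq, not_or, not_exists] at hn
  refine hy ?_
  rw [rate_eq, rightPart, leftPart,
    Finset.sum_eq_zero fun s hs => Finset.sum_eq_zero fun k hk => if_neg (hn.1 s hs k hk),
    Finset.sum_eq_zero fun s hs => Finset.sum_eq_zero fun k hk => if_neg (hn.2 s hs k hk),
    add_zero]

theorem rightRate_nonneg {v : ℕ → ℝ} (hv : ∀ k ∈ Finset.Icc 1 n, 0 < v k ∧ v k < 1) (x : State n)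
    {i j : ℕ} (hij : (i, j) ∈ triangle n) : 0 ≤ rightRate n v x i j := by
  rw [mem_triangle] at hij
  have h1 := (hv (n - j + 1) (by rw [Finset.mem_Icc]; omega)).1
  unfold rightRate
  split_ifs with h
  · have h2 := (hv (i - 1) (by rw [Finset.mem_Icc]; omega)).1
    positivity
  · positivity

theorem leftRate_pos {v : ℕ → ℝ} (hv : ∀ k ∈ Finset.Icc 1 n, 0 < v k ∧ v k < 1) (x : State n)
    {i j : ℕ} (hij : (i, j) ∈ triangle n) : 0 < leftRate n v x i j := by
  rw [mem_triangle] at hij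
  have h1 := (hv (n - j + 1) (by rw [Finset.mem_Icc]; omega)).1
  unfold leftRate
  split_ifs with h
  · have h2 := (hv (i - 1) (by rw [Finset.mem_Icc]; omega)).1
    positivity
  · positivity

theorem rightPart_nonneg {v : ℕ → ℝ} (hv : ∀ k ∈ Finset.Icc 1 n, 0 < v k ∧ v k < 1)
    (x y : State n) : 0 ≤ rightPart n v x y :=
  Finset.sum_nonneg fun s hs => Finset.sum_nonneg fun k _ => by
    split_ifs
    · exact rightRate_nonneg hv x hs
    · rfl

theorem rate_nonneg {v : ℕ → ℝ} (hv : ∀ k ∈ Finset.Icc 1 n, 0 < v k ∧ v k < 1) (x y : State n) :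
    0 ≤ rate n v x y := by
  rw [rate_eq]
  refine add_nonneg (rightPart_nonneg hv x y) (Finset.sum_nonneg fun s hs =>
    Finset.sum_nonneg fun k _ => ?_)
  split_ifs
  · exact (leftRate_pos hv x hs).le
  · rfl

theorem rate_pos_of_isLeftJump {v : ℕ → ℝ} (hv : ∀ k ∈ Finset.Icc 1 n, 0 < v k ∧ v k < 1)
    {x y : State n} {i j l : ℕ} (hij : (i, j) ∈ triangle n) (hl : l ∈ Finset.Icc i (n + 1 - j))
    (h : IsLeftJump x y i j l) : 0 < rate n v x y := by
  classical
  rw [rate_eq]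
  refine add_pos_of_nonneg_of_pos (rightPart_nonneg hv x y) ?_
  have h0 : ∀ s ∈ triangle n, ∀ l, (0 : ℝ) ≤
      if IsLeftJump x y s.1 s.2 l then leftRate n v x s.1 s.2 else 0 := fun s hs l => by
    split_ifs
    · exact (leftRate_pos hv x hs).le
    · rfl
  refine Finset.sum_pos' (fun s hs => Finset.sum_nonneg fun l _ => h0 s hs l)
    ⟨(i, j), hij, Finset.sum_pos' (fun l _ => h0 _ hij l) ⟨l, hl, ?_⟩⟩
  rw [if_pos h]
  exact leftRate_pos hv x hij

theorem rate_self (v : ℕ → ℝ) (x : State n) : rate n v x x = 0 := by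
  rw [rate_eq, rightPart, leftPart,
    Finset.sum_eq_zero fun s hs => Finset.sum_eq_zero fun k hk => if_neg ?_,
    Finset.sum_eq_zero fun s hs => Finset.sum_eq_zero fun k hk => if_neg ?_, add_zero]
  · intro h
    have := h.1 ⟨s, hs⟩
    rw [Finset.mem_Icc] at hk
    simp at this
    omega
  · intro h
    have := h.1 ⟨s, hs⟩
    rw [Finset.mem_Icc] at hk
    simp at this
    omega

/-- The bound does not depend on `x`. Absolute values are used because the formula mentions `v 0` at
`i = 1`, whose sign is unknown. -/
theorem exitRate_le (v : ℕ → ℝ) (x : State n) : exitRate n v x ≤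
    ∑ s ∈ triangle n, ((|v (n - s.2 + 1)| * (|(v (n - s.2 + 1) * v (s.1 - 1))⁻¹| + 1)) +
      |(v (n - s.2 + 1))⁻¹| * (|v (s.1 - 1) * v (n - s.2 + 1)| + 1)) := by
  have key : ∀ (p q : Prop) [Decidable p] [Decidable q] (a b : ℝ),
      (if p then a * (if q then b else 1) else 0) ≤ |a| * (|b| + 1) := by
    intro p q _ _ a b
    have h1 : |a| * |b| ≥ a * b := by rw [← abs_mul]; exact le_abs_self _
    have h2 := le_abs_self a
    have h3 := abs_nonneg a
    have h4 : 0 ≤ |a| * |b| := by positivity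
    split_ifs <;> nlinarith
  exact Finset.sum_le_sum fun s _ => add_le_add (key _ _ _ _) (key _ _ _ _)

/-- The empty configuration can be reached from every state. -/
theorem reflTransGen_zero {v : ℕ → ℝ} (hv : ∀ k ∈ Finset.Icc 1 n, 0 < v k ∧ v k < 1)
    (x : State n) :
    Relation.ReflTransGen (fun a b : State n => 0 < rate n v a b) x ⟨fun _ => 0, by simp⟩ := by
  induction hN : ∑ s, x.1 s using Nat.strong_induction_on generalizing x with
  | _ N ih =>
    -- An unblocked left jump lowers the total of the entries. If every left jump is blocked, each
    -- row is nondecreasing up to the value `0` beyond the triangle, so all entries vanish.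
    by_cases h : ∃ i j, (i, j) ∈ triangle n ∧ coord x i (j + 1) < coord x i j
    · obtain ⟨i, j, hij, h⟩ := h
      obtain ⟨l, hl, y, hy⟩ := exists_isLeftJump_iff x hij h
      have hjump := (hy l hl y).2 ⟨rfl, rfl⟩
      refine Relation.ReflTransGen.head (rate_pos_of_isLeftJump hv hij hl hjump) (ih _ ?_ y rfl)
      rw [← hN]
      refine Finset.sum_lt_sum (fun s _ => by rw [hjump.1 s]; exact Nat.le_add_right _ _)
        ⟨⟨(i, j), hij⟩, Finset.mem_univ _, ?_⟩
      rw [hjump.1 ⟨(i, j), hij⟩, if_pos ⟨rfl, le_rfl, (Finset.mem_Icc.1 hl).1⟩]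
      omega
    · push Not at h
      have h0 : ∀ m i j, n + 1 - j ≤ m → (i, j) ∈ triangle n → coord x i j = 0 := by
        intro m
        induction m with
        | zero => intro i j hm hij; rw [mem_triangle] at hij; omega
        | succ m ihm =>
          intro i j hm hij
          have h1 := h i j hij
          by_cases h2 : (i, j + 1) ∈ triangle n
          · have := ihm i (j + 1) (by omega) h2
            omega
          · rw [coord_of_notMem x h2] at h1
            omega
      have : x = ⟨fun _ => 0, by simp⟩ := state_ext fun i j hij => by
        rw [h0 _ i j le_rfl hij, coord_of_mem _ hij]
      rw [← this]

end Arrays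

/-! ### The reversed rates: equal exit rates and detailed balance -/

section Reversal

variable {n : ℕ}

/-- The parameters in reverse order. -/
def reverse (n : ℕ) (v : ℕ → ℝ) : ℕ → ℝ := fun k => v (n + 1 - k)

theorem reverse_mem {v : ℕ → ℝ} (hv : ∀ k ∈ Finset.Icc 1 n, 0 < v k ∧ v k < 1) :
    ∀ k ∈ Finset.Icc 1 n, 0 < reverse n v k ∧ reverse n v k < 1 := fun k hk =>
  hv _ (by rw [Finset.mem_Icc] at hk ⊢; omega)

theorem reverse_reverse (v : ℕ → ℝ) {k : ℕ} (hk : k ≤ n + 1) :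
    reverse n (reverse n v) k = v k := by
  simp only [reverse]
  congr 1
  omega

/-! ### Equality of the exit rates -/

theorem sum_triangle (f : ℕ → ℕ → ℝ) :
    ∑ s ∈ triangle n, f s.1 s.2 =
      ∑ a ∈ Finset.range n, ∑ b ∈ Finset.range (n - a), f (a + 1) (b + 1) := by
  rw [Finset.sum_sigma']
  refine Finset.sum_nbij' (fun s => ⟨s.1 - 1, s.2 - 1⟩) (fun p => (p.1 + 1, p.2 + 1)) ?_ ?_ ?_ ?_ ?_
  · rintro ⟨i, j⟩ h
    rw [mem_triangle] at h
    simp only [Finset.mem_sigma, Finset.mem_range]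
    omega
  · rintro ⟨a, b⟩ h
    simp only [Finset.mem_sigma, Finset.mem_range] at h
    rw [mem_triangle]
    dsimp only at h ⊢
    omega
  · rintro ⟨i, j⟩ h
    rw [mem_triangle] at h
    simp only [Prod.mk.injEq]
    omega
  · rintro ⟨a, b⟩ _
    rfl
  · rintro ⟨i, j⟩ h
    rw [mem_triangle] at h
    simp only
    rw [Nat.sub_add_cancel h.1, Nat.sub_add_cancel h.2.1]

theorem sum_range_range_comm (N : ℕ) (f : ℕ → ℕ → ℝ) :
    ∑ a ∈ Finset.range N, ∑ b ∈ Finset.range (N - a), f a b =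
      ∑ b ∈ Finset.range N, ∑ a ∈ Finset.range (N - b), f a b :=
  Finset.sum_comm' fun a b => by simp only [Finset.mem_range]; omega

theorem sum_triangle_first_row (N : ℕ) (f : ℕ → ℕ → ℝ) :
    ∑ s ∈ triangle (N + 1), f s.1 s.2 =
      ∑ a ∈ Finset.range N, ∑ b ∈ Finset.range (N - a), f (a + 2) (b + 1) +
        ∑ b ∈ Finset.range (N + 1), f 1 (b + 1) := by
  rw [sum_triangle, Finset.sum_range_succ']
  simp [Nat.add_sub_add_right]

theorem sum_triangle_first_column (N : ℕ) (f : ℕ → ℕ → ℝ) :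
    ∑ s ∈ triangle (N + 1), f s.2 s.1 =
      ∑ a ∈ Finset.range N, ∑ b ∈ Finset.range (N - a), f (a + 1) (b + 2) +
        ∑ b ∈ Finset.range (N + 1), f (b + 1) 1 := by
  rw [sum_triangle_first_row N fun i j => f j i, sum_range_range_comm]

/-- The exchange identity on a square with corner values `d ≤ b, c ≤ a`. -/
theorem square_identity {u z : ℝ} (hu : u ≠ 0) (hz : z ≠ 0) {a b c d : ℕ} (hba : b ≤ a)
    (hca : c ≤ a) (hdb : d ≤ b) (hdc : d ≤ c) :
    ((if b < a then u * (if c ≤ b then (u * z)⁻¹ else 1) else 0) +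
        if d < b then u⁻¹ * (if c < b then z * u else 1) else 0) =
      ((if c < a then z * (if b ≤ c then (z * u)⁻¹ else 1) else 0) +
        if d < c then z⁻¹ * (if b < c then u * z else 1) else 0) +
      (z⁻¹ * ((if b < a then 1 else 0) - if d < c then 1 else 0) -
        u⁻¹ * ((if c < a then 1 else 0) - if d < b then 1 else 0)) := by
  rcases lt_trichotomy b c with h | h | h
  · simp only [h, h.not_ge, h.not_gt, h.le, h.trans_le hca, hdb.trans_lt h, if_true, if_false]
    split_ifs <;> field_simp <;> ring
  · subst h
    simp only [le_refl, lt_irrefl, if_true, if_false]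
    split_ifs <;> field_simp <;> ring
  · simp only [h, h.not_ge, h.not_gt, h.le, h.trans_le hba, hdc.trans_lt h, if_true, if_false]
    split_ifs <;> field_simp <;> ring

/-- The term of the particle at `(i, j)` in the exit rate. -/
def siteExitRate (n : ℕ) (v : ℕ → ℝ) (x : State n) (i j : ℕ) : ℝ :=
  (if i = 1 ∨ coord x i j < coord x (i - 1) j then rightRate n v x i j else 0) +
    if coord x i (j + 1) < coord x i j then leftRate n v x i j else 0

theorem siteExitRate_one (v : ℕ → ℝ) (x : State n) (j : ℕ) :
    siteExitRate n v x 1 j =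
      v (n - j + 1) + (v (n - j + 1))⁻¹ * if coord x 1 (j + 1) < coord x 1 j then 1 else 0 := by
  simp [siteExitRate, rightRate, leftRate]

theorem siteExitRate_succ (v : ℕ → ℝ) (x : State n) {m : ℕ} (hm : 1 ≤ m) (j : ℕ) :
    siteExitRate n v x (m + 1) j =
      ((if coord x (m + 1) j < coord x m j then v (n - j + 1) *
          (if coord x m (j + 1) ≤ coord x (m + 1) j then (v (n - j + 1) * v m)⁻¹ else 1) else 0) +
        if coord x (m + 1) (j + 1) < coord x (m + 1) j then (v (n - j + 1))⁻¹ *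
          (if coord x m (j + 1) < coord x (m + 1) j then v m * v (n - j + 1) else 1) else 0) := by
  have h : m ≠ 0 := by omega
  simp [siteExitRate, rightRate, leftRate, h]

/-- `square_identity` compares site `(i+1, j)` of `x` with site `(j+1, i)` of the transpose. Its two
corrections telescope, one along rows and one along columns. Their ends in the first column and
first row match the left-jump terms of the unmodulated particles, and their ends on the antidiagonal
cancel. -/
theorem exitRate_transpose (hn : 1 ≤ n) {v : ℕ → ℝ}
    (hv : ∀ k ∈ Finset.Icc 1 n, 0 < v k ∧ v k < 1) (x : State n) :
    exitRate n v x = exitRate n (reverse n v) (transpose n x) := by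
  obtain ⟨N, rfl⟩ : ∃ N, n = N + 1 := ⟨n - 1, by omega⟩
  set h : ℕ → ℕ → ℝ := fun i j => if coord x (i + 1) j < coord x i j then 1 else 0 with hh
  set g : ℕ → ℕ → ℝ := fun i j => if coord x i (j + 1) < coord x i j then 1 else 0 with hg
  have hsq : ∀ a ∈ Finset.range N, ∀ b ∈ Finset.range (N - a),
      siteExitRate (N + 1) v x (a + 2) (b + 1) =
        siteExitRate (N + 1) (reverse (N + 1) v) (transpose (N + 1) x) (b + 2) (a + 1) +
        ((v (a + 1))⁻¹ * (h (a + 1) (b + 1) - h (a + 1) (b + 2)) -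
          (v (N + 1 - b))⁻¹ * (g (a + 1) (b + 1) - g (a + 2) (b + 1))) := by
    intro a ha b hb
    rw [Finset.mem_range] at ha hb
    rw [siteExitRate_succ v x (m := a + 1) (by omega),
      siteExitRate_succ _ (transpose (N + 1) x) (m := b + 1) (by omega)]
    simp only [coord_transpose, reverse]
    have e1 : N + 1 - (b + 1) + 1 = N + 1 - b := by omega
    have e2 : N + 1 + 1 - (N + 1 - (a + 1) + 1) = a + 1 := by omega
    have e3 : N + 1 + 1 - (b + 1) = N + 1 - b := by omega
    rw [e1, e2, e3]
    exact square_identity (hv _ (by rw [Finset.mem_Icc]; omega)).1.ne'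
      (hv _ (by rw [Finset.mem_Icc]; omega)).1.ne' (coord_succ_left x (by omega) _)
      (coord_succ_right x _ (by omega)) (coord_succ_right x _ (by omega))
      (coord_succ_left x (by omega) _)
  have hz : ∑ a ∈ Finset.range N, ∑ b ∈ Finset.range (N - a),
      (v (a + 1))⁻¹ * (h (a + 1) (b + 1) - h (a + 1) (b + 2)) =
      ∑ a ∈ Finset.range (N + 1), (v (a + 1))⁻¹ * (h (a + 1) 1 - h (a + 1) (N - a + 1)) := by
    rw [Finset.sum_range_succ]
    simp only [← Finset.mul_sum, Finset.sum_range_sub' (fun b => h _ (b + 1)), Nat.sub_self,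
      zero_add, sub_self, mul_zero, add_zero]
  have hu : ∑ a ∈ Finset.range N, ∑ b ∈ Finset.range (N - a),
      (v (N + 1 - b))⁻¹ * (g (a + 1) (b + 1) - g (a + 2) (b + 1)) =
      ∑ b ∈ Finset.range (N + 1), (v (N + 1 - b))⁻¹ * (g 1 (b + 1) - g (N - b + 1) (b + 1)) := by
    rw [sum_range_range_comm, Finset.sum_range_succ]
    simp only [← Finset.mul_sum, Finset.sum_range_sub' (fun a => g (a + 1) _), Nat.sub_self,
      zero_add, sub_self, mul_zero, add_zero]
  -- On the antidiagonal both indicators say that the entry is positive, since both larger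
  -- neighbours are `0`, and the parameters agree because `i = n - j + 1` there.
  have hbd : ∑ a ∈ Finset.range (N + 1), (v (a + 1))⁻¹ * h (a + 1) (N - a + 1) =
      ∑ b ∈ Finset.range (N + 1), (v (N + 1 - b))⁻¹ * g (N - b + 1) (b + 1) := by
    rw [← Finset.sum_range_reflect]
    refine Finset.sum_congr rfl fun b hb => ?_
    rw [Finset.mem_range] at hb
    have e1 : N + 1 - 1 - b + 1 = N + 1 - b := by omega
    have e2 : N - (N + 1 - 1 - b) + 1 = b + 1 := by omega
    have e3 : N - b + 1 = N + 1 - b := by omega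
    rw [e1, e2, e3]
    congr 1
    simp only [hh, hg]
    rw [coord_of_notMem x (i := N + 1 - b + 1) (by rw [mem_triangle]; omega),
      coord_of_notMem x (i := N + 1 - b) (j := b + 1 + 1) (by rw [mem_triangle]; omega)]
  have hv2 : ∑ b ∈ Finset.range (N + 1), v (N + 1 - b) = ∑ a ∈ Finset.range (N + 1), v (a + 1) := by
    rw [← Finset.sum_range_reflect]
    refine Finset.sum_congr rfl fun b hb => ?_
    rw [Finset.mem_range] at hb
    congr 1
    omega
  have hrow : ∑ b ∈ Finset.range (N + 1), siteExitRate (N + 1) v x 1 (b + 1) =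
      ∑ b ∈ Finset.range (N + 1), v (N + 1 - b) +
        ∑ b ∈ Finset.range (N + 1), (v (N + 1 - b))⁻¹ * g 1 (b + 1) := by
    rw [← Finset.sum_add_distrib]
    refine Finset.sum_congr rfl fun b hb => ?_
    rw [Finset.mem_range] at hb
    rw [siteExitRate_one, show N + 1 - (b + 1) + 1 = N + 1 - b by omega]
  have hcol : ∑ a ∈ Finset.range (N + 1),
      siteExitRate (N + 1) (reverse (N + 1) v) (transpose (N + 1) x) 1 (a + 1) =
      ∑ a ∈ Finset.range (N + 1), v (a + 1) +
        ∑ a ∈ Finset.range (N + 1), (v (a + 1))⁻¹ * h (a + 1) 1 := by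
    rw [← Finset.sum_add_distrib]
    refine Finset.sum_congr rfl fun a ha => ?_
    rw [Finset.mem_range] at ha
    rw [siteExitRate_one]
    simp only [coord_transpose, reverse]
    rw [show N + 1 + 1 - (N + 1 - (a + 1) + 1) = a + 1 by omega]
  have hL : exitRate (N + 1) v x = _ := sum_triangle_first_row N (siteExitRate (N + 1) v x)
  have hR : exitRate (N + 1) (reverse (N + 1) v) (transpose (N + 1) x) = _ :=
    sum_triangle_first_column N
      fun i j => siteExitRate (N + 1) (reverse (N + 1) v) (transpose (N + 1) x) j i
  rw [hL, hR, Finset.sum_congr rfl fun a ha => Finset.sum_congr rfl (hsq a ha)]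
  simp only [Finset.sum_add_distrib, Finset.sum_sub_distrib]
  rw [hz, hu, hrow, hcol, hv2]
  simp only [mul_sub, Finset.sum_sub_distrib]
  rw [hbd]
  ring

/-! ### Detailed balance -/

/-- The parameter of the geometric variable at `(i, j)`. -/
def envParam (n : ℕ) (v : ℕ → ℝ) (i j : ℕ) : ℝ := v i * v (n - j + 1)

/-- The increment of `x` at `(i, j)` over the larger of its values at `(i + 1, j)` and
`(i, j + 1)`. -/
def incr (x : State n) (i j : ℕ) : ℕ := coord x i j - max (coord x (i + 1) j) (coord x i (j + 1))

/-- The stationary weight of a state. -/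
def weight (n : ℕ) (v : ℕ → ℝ) (x : State n) : ℝ :=
  ∏ s ∈ triangle n, (1 - envParam n v s.1 s.2) * envParam n v s.1 s.2 ^ incr x s.1 s.2

theorem weight_reverse_transpose (v : ℕ → ℝ) (x : State n) :
    weight n (reverse n v) (transpose n x) = weight n v x := by
  have hswap : ∀ s ∈ triangle n, s.swap ∈ triangle n := by
    rintro ⟨i, j⟩ h
    rw [Prod.swap_prod_mk, mem_triangle]
    rw [mem_triangle] at h
    omega
  refine Finset.prod_nbij' Prod.swap Prod.swap hswap hswap (fun _ _ => Prod.swap_swap _)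
    (fun _ _ => Prod.swap_swap _) ?_
  rintro ⟨i, j⟩ h
  rw [mem_triangle] at h
  have h1 : envParam n (reverse n v) i j = envParam n v j i := by
    simp only [envParam, reverse]
    rw [mul_comm, show n + 1 - (n - j + 1) = j by omega, show n + 1 - i = n - i + 1 by omega]
  have h2 : incr (transpose n x) i j = incr x j i := by
    simp only [incr, coord_transpose, max_comm]
  simp only [Prod.swap_prod_mk, h1, h2]

/-- The front `(i, j)` gains one. Inside the block, entries and their maxima move together. Behind
the block, `(i, k-1)` loses one exactly when `x_{ik}` attains its maximum; above the front, `(i-1,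
j)` loses one exactly when `x_{ij}` does. The other sites of row `i - 1` above the block are
protected, since the move is not blocked. The losses stand on the left to avoid truncated
subtraction. -/
theorem incr_rightJump {x y : State n} {i j k : ℕ} (hij : (i, j) ∈ triangle n) (hk : 1 ≤ k)
    (hkj : k ≤ j) (h : IsRightJump x y i j k) {a b : ℕ} (ha : 1 ≤ a) (hb : 1 ≤ b) :
    incr y a b + ((if (i ≠ 1 ∧ coord x (i - 1) (j + 1) ≤ coord x i j) ∧ (a, b) = (i - 1, j)
        then 1 else 0) +
      if (k ≠ 1 ∧ coord x (i + 1) (k - 1) ≤ coord x i k) ∧ (a, b) = (i, k - 1) then 1 else 0) =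
    incr x a b + if (a, b) = (i, j) then 1 else 0 := by
  rw [isRightJump_iff hij hk] at h
  obtain ⟨h1, h2⟩ := h
  rw [mem_triangle] at hij
  have x1 := coord_succ_left x ha b
  have x2 := coord_succ_right x a hb
  have y1 := coord_succ_left y ha b
  have y2 := coord_succ_right y a hb
  have e0 := h1 a b
  have e1 := h1 (a + 1) b
  have e2 := h1 a (b + 1)
  simp only [incr, Prod.mk.injEq]
  by_cases hai : a = i
  · subst hai
    rw [if_neg (by omega)] at e1
    rw [if_neg (show ¬(_ ∧ a = a - 1 ∧ b = j) by omega)]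
    rcases lt_or_ge b (k - 1) with hb1 | hb1
    · rw [if_neg (by omega)] at e0 e2
      rw [if_neg (show ¬(_ ∧ a = a ∧ b = k - 1) by omega),
        if_neg (show ¬(a = a ∧ b = j) by omega)]
      omega
    rcases Nat.lt_or_ge b k with hb2 | hb2
    · obtain rfl : k = b + 1 := by omega
      rw [if_neg (by omega)] at e0
      rw [if_pos ⟨rfl, le_rfl, hkj⟩] at e2
      rw [if_neg (show ¬(a = a ∧ b = j) by omega)]
      simp only [Nat.add_sub_cancel, and_self, and_true]
      split_ifs <;> omega
    rw [if_neg (show ¬(_ ∧ a = a ∧ b = k - 1) by omega)]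
    rcases Nat.lt_or_ge b j with hb3 | hb3
    · rw [if_pos (by omega)] at e0 e2
      rw [if_neg (show ¬(a = a ∧ b = j) by omega)]
      have e3 := h2 b hb2 (by omega)
      have e4 := h2 (b + 1) (by omega) (by omega)
      omega
    rw [if_neg (by omega)] at e2
    rcases hb3.eq_or_lt with rfl | hb3
    · rw [if_pos (by omega)] at e0
      simp only [and_self, if_true]
      omega
    · rw [if_neg (by omega)] at e0
      rw [if_neg (by omega)]
      omega
  · rw [if_neg (by omega)] at e0 e2
    rw [if_neg (show ¬(_ ∧ a = i ∧ b = k - 1) by omega), if_neg (show ¬(a = i ∧ b = j) by omega)]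
    by_cases hai' : a + 1 = i
    · subst hai'
      simp only [Nat.add_sub_cancel]
      have e5 : b < j → coord x a j ≤ coord x a (b + 1) := fun h =>
        coord_anti_right x a (by omega) (by omega)
      have e6 := h1 a j
      have e7 := h1 (a + 1) j
      have e8 := coord_succ_left y ha j
      rw [if_neg (by omega)] at e6
      rw [if_pos (by omega)] at e7
      by_cases hbk : k ≤ b ∧ b ≤ j
      · have e3 := h2 b hbk.1 hbk.2
        rw [if_pos ⟨rfl, hbk⟩] at e1
        rcases hbk.2.eq_or_lt with rfl | hlt
        · simp only [and_self, and_true]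
          split_ifs <;> omega
        · have := e5 hlt
          rw [if_neg (by omega)]
          omega
      · rw [if_neg (by omega)] at e1
        rw [if_neg (by omega)]
        omega
    · rw [if_neg (by omega)] at e1
      rw [if_neg (by omega)]
      omega

/-- The weight ratio is the parameter at `(i, j)` divided by those of the sites that lose one. The
loss at `(i-1, j)` is the modulation of the right rate, the loss at `(i, k-1)` that of the reversed
left rate, and `v_i v_{n-j+1}` is the ratio of the unmodulated rates. -/
theorem weight_mul_rightRate {v : ℕ → ℝ} (hv : ∀ k ∈ Finset.Icc 1 n, 0 < v k ∧ v k < 1)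
    {x y : State n} {i j k : ℕ} (hij : (i, j) ∈ triangle n) (hk : 1 ≤ k) (hkj : k ≤ j)
    (h : IsRightJump x y i j k) :
    weight n v x * rightRate n v x i j =
      weight n v y * leftRate n (reverse n v) (transpose n y) k i := by
  classical
  have hij' := mem_triangle.1 hij
  have hmul : ∀ (x : State n) (γ : ℕ × ℕ → ℕ),
      weight n v x * ∏ s ∈ triangle n, envParam n v s.1 s.2 ^ γ s =
        ∏ s ∈ triangle n, (1 - envParam n v s.1 s.2) *
          envParam n v s.1 s.2 ^ (incr x s.1 s.2 + γ s) := by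
    intro x γ
    rw [weight, ← Finset.prod_mul_distrib]
    exact Finset.prod_congr rfl fun s _ => by rw [pow_add, mul_assoc]
  set D1 := i ≠ 1 ∧ coord x (i - 1) (j + 1) ≤ coord x i j with hD1
  set D2 := k ≠ 1 ∧ coord x (i + 1) (k - 1) ≤ coord x i k with hD2
  have hprod : ∀ (D : Prop) [Decidable D] (p : ℕ × ℕ), (D → p ∈ triangle n) →
      ∏ s ∈ triangle n, envParam n v s.1 s.2 ^ (if D ∧ s = p then 1 else 0) =
        if D then envParam n v p.1 p.2 else 1 := by
    intro D _ p hp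
    by_cases hD : D
    · simp [hD, pow_ite, hp hD]
    · simp [hD]
  have key := hmul y fun s => (if D1 ∧ s = (i - 1, j) then 1 else 0) +
    if D2 ∧ s = (i, k - 1) then 1 else 0
  have key' := hmul x fun s => if True ∧ s = (i, j) then 1 else 0
  have heq : weight n v y * ∏ s ∈ triangle n, envParam n v s.1 s.2 ^
        ((if D1 ∧ s = (i - 1, j) then 1 else 0) + if D2 ∧ s = (i, k - 1) then 1 else 0) =
      weight n v x * ∏ s ∈ triangle n, envParam n v s.1 s.2 ^
        (if True ∧ s = (i, j) then 1 else 0) := by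
    rw [key, key']
    refine Finset.prod_congr rfl fun s hs => ?_
    obtain ⟨a, b⟩ := s
    have hab := mem_triangle.1 hs
    simp only [true_and]
    rw [incr_rightJump hij hk hkj h hab.1 hab.2.1]
  simp only [pow_add, Finset.prod_mul_distrib] at heq
  rw [hprod D1 (i - 1, j) (fun hD => by rw [mem_triangle]; omega),
    hprod D2 (i, k - 1) (fun hD => by rw [mem_triangle]; omega),
    hprod True (i, j) (fun _ => hij), if_pos trivial] at heq
  have hy := (isRightJump_iff hij hk).1 h
  have hy1 : coord y i k = coord x i k + 1 := by rw [hy.1, if_pos ⟨rfl, le_rfl, hkj⟩]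
  have hy2 : coord y (i + 1) (k - 1) = coord x (i + 1) (k - 1) := by
    rw [hy.1, if_neg (by omega)]; rfl
  have hl : leftRate n (reverse n v) (transpose n y) k i =
      (v i)⁻¹ * if D2 then v (n - (k - 1) + 1) * v i else 1 := by
    -- The strict comparison in the left rate is made after the jump, where the entry is one larger,
    -- so it becomes the weak comparison `D2` before the jump.
    simp only [leftRate, coord_transpose, reverse, hy1, hy2, Nat.lt_succ_iff]
    rw [show n + 1 - (n - i + 1) = i by omega, show n + 1 - (k - 1) = n - (k - 1) + 1 by omega]
  have hr : rightRate n v x i j =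
      v (n - j + 1) * if D1 then (v (n - j + 1) * v (i - 1))⁻¹ else 1 := rfl
  rw [hl, hr]
  simp only [envParam] at heq
  have p1 := (hv i (by rw [Finset.mem_Icc]; omega)).1.ne'
  have p2 := (hv (n - j + 1) (by rw [Finset.mem_Icc]; omega)).1.ne'
  have p3 : D1 → v (i - 1) ≠ 0 := fun hD => (hv _ (by rw [Finset.mem_Icc]; omega)).1.ne'
  have p4 : D2 → v (n - (k - 1) + 1) ≠ 0 := fun hD => (hv _ (by rw [Finset.mem_Icc]; omega)).1.ne'
  by_cases d1 : D1 <;> by_cases d2 : D2 <;> simp only [d1, d2, if_true, if_false] at heq ⊢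
  · have := p3 d1
    have := p4 d2
    field_simp at heq ⊢
    linear_combination -heq
  · have := p3 d1
    field_simp at heq ⊢
    linear_combination -heq
  · have := p4 d2
    field_simp at heq ⊢
    linear_combination -heq
  · field_simp
    linear_combination -heq

theorem weight_mul_rightPart {v : ℕ → ℝ} (hv : ∀ k ∈ Finset.Icc 1 n, 0 < v k ∧ v k < 1)
    (x y : State n) :
    weight n v x * rightPart n v x y =
      weight n v y * leftPart n (reverse n v) (transpose n y) (transpose n x) := by
  classical
  simp only [rightPart, leftPart, Finset.mul_sum, Finset.sum_sigma']
  refine Finset.sum_nbij' (fun p => ⟨(p.2, p.1.1), p.1.2⟩) (fun p => ⟨(p.1.2, p.2), p.1.1⟩)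
    ?_ ?_ ?_ ?_ ?_
  · rintro ⟨⟨i, j⟩, k⟩ h
    simp only [Finset.mem_sigma, Finset.mem_Icc, mem_triangle] at h ⊢
    omega
  · rintro ⟨⟨i, j⟩, k⟩ h
    simp only [Finset.mem_sigma, Finset.mem_Icc, mem_triangle] at h ⊢
    omega
  · rintro ⟨⟨i, j⟩, k⟩ _
    rfl
  · rintro ⟨⟨i, j⟩, k⟩ _
    rfl
  · rintro ⟨⟨i, j⟩, k⟩ h
    simp only [Finset.mem_sigma, Finset.mem_Icc] at h
    simp only [isLeftJump_transpose_iff h.1 h.2.1 h.2.2, mul_ite, mul_zero]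
    split_ifs with hj
    · exact weight_mul_rightRate hv h.1 h.2.1 h.2.2 hj
    · rfl

theorem leftPart_reverse_reverse (v : ℕ → ℝ) (x y : State n) :
    leftPart n (reverse n (reverse n v)) x y = leftPart n v x y := by
  refine Finset.sum_congr rfl fun s hs => ?_
  have hs' := (mem_triangle (i := s.1) (j := s.2)).1 hs
  simp only [leftRate, reverse_reverse v (n := n) (k := n - s.2 + 1) (by omega),
    reverse_reverse v (n := n) (k := s.1 - 1) (by omega)]

/-- The reversal of the rates with respect to the stationary weights is, after transposition, the
family of rates with the parameters in reverse order. -/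
theorem weight_mul_rate {v : ℕ → ℝ} (hv : ∀ k ∈ Finset.Icc 1 n, 0 < v k ∧ v k < 1)
    (x y : State n) :
    weight n v x * rate n v x y =
      weight n v y * rate n (reverse n v) (transpose n y) (transpose n x) := by
  -- Left jumps need no separate computation: they are the right-jump balance for the reversed
  -- parameters and transposed states, since both operations are involutive on the indices used.
  have h := weight_mul_rightPart (reverse_mem hv) (transpose n y) (transpose n x)
  rw [weight_reverse_transpose, weight_reverse_transpose, transpose_transpose, transpose_transpose,
    leftPart_reverse_reverse] at h
  rw [rate_eq, rate_eq, mul_add, mul_add, weight_mul_rightPart hv, h, add_comm]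

end Reversal

/-! ### The law of the last passage times -/

section LastPassage

variable {n : ℕ}

theorem add_lpp_le (g : Site n → ℕ) {s t : Site n} (h : Next s t) : g s + lpp g t ≤ lpp g s := by
  obtain ⟨p, ⟨hp1, hp2, hp3⟩, hw⟩ := (isGreatest_lpp g t).1
  refine (isGreatest_lpp g s).2 ⟨s :: p, ?_, by simp [hw]⟩
  cases p with
  | nil => simp at hp1
  | cons a p =>
    simp only [List.head?_cons, Option.some.injEq] at hp1
    subst hp1
    exact ⟨rfl, List.isChain_cons_cons.2 ⟨h, hp2⟩, by simpa using hp3⟩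

theorem le_lpp (g : Site n → ℕ) (s : Site n) : g s ≤ lpp g s := by
  obtain ⟨p, ⟨hp1, _, _⟩, hw⟩ := (isGreatest_lpp g s).1
  cases p with
  | nil => simp at hp1
  | cons a p =>
    simp only [List.head?_cons, Option.some.injEq] at hp1
    subst hp1
    simp only [List.map_cons, List.sum_cons] at hw
    omega

theorem lpp_cases (g : Site n → ℕ) (s : Site n) :
    lpp g s = g s ∨ ∃ t, Next s t ∧ lpp g s ≤ g s + lpp g t := by
  obtain ⟨p, ⟨hp1, hp2, hp3⟩, hw⟩ := (isGreatest_lpp g s).1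
  rcases p with _ | ⟨a, _ | ⟨t, p⟩⟩
  · simp at hp1
  · simp only [List.head?_cons, Option.some.injEq] at hp1
    subst hp1
    left
    simpa using hw.symm
  · simp only [List.head?_cons, Option.some.injEq] at hp1
    subst hp1
    rw [List.isChain_cons_cons] at hp2
    refine Or.inr ⟨t, hp2.1, ?_⟩
    rw [← hw, List.map_cons, List.sum_cons]
    gcongr
    exact (isGreatest_lpp g t).2 ⟨t :: p, ⟨rfl, hp2.2, by simpa using hp3⟩, rfl⟩

/-- The field of last passage times, as a state. -/
def lppState (g : Site n → ℕ) : State n :=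
  ⟨lpp g, fun _ _ h => (Nat.le_add_left _ _).trans (add_lpp_le g h)⟩

theorem coord_lppState (g : Site n → ℕ) {i j : ℕ} (h : (i, j) ∈ triangle n) :
    coord (lppState g) i j = g ⟨(i, j), h⟩ +
      max (coord (lppState g) (i + 1) j) (coord (lppState g) i (j + 1)) := by
  have hco : ∀ (a b : ℕ) (hab : (a, b) ∈ triangle n),
      coord (lppState g) a b = lpp g ⟨(a, b), hab⟩ := fun a b hab => coord_of_mem _ hab
  apply le_antisymm
  · rw [hco i j h]
    rcases lpp_cases g ⟨(i, j), h⟩ with h1 | ⟨⟨⟨a, b⟩, hab⟩, hn | hn, h1⟩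
    · omega
    all_goals
      obtain ⟨rfl, rfl⟩ := Prod.mk.inj hn
      rw [← hco _ _ hab] at h1
      exact h1.trans (by gcongr; simp)
  · rw [hco i j h]
    have h0 := le_lpp g ⟨(i, j), h⟩
    have h1 : g ⟨(i, j), h⟩ + coord (lppState g) (i + 1) j ≤ lpp g ⟨(i, j), h⟩ := by
      by_cases hab : (i + 1, j) ∈ triangle n
      · rw [hco _ _ hab]
        exact add_lpp_le g (Or.inl rfl)
      · rwa [coord_of_notMem _ hab, add_zero]
    have h2 : g ⟨(i, j), h⟩ + coord (lppState g) i (j + 1) ≤ lpp g ⟨(i, j), h⟩ := by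
      by_cases hab : (i, j + 1) ∈ triangle n
      · rw [hco _ _ hab]
        exact add_lpp_le g (Or.inr rfl)
      · rwa [coord_of_notMem _ hab, add_zero]
    rw [← max_add_add_left]
    exact max_le h1 h2

/-- The recursion for the passage times recovers the environment as the increments; conversely it
rebuilds the state from its increments, by induction on the distance to the antidiagonal. -/
theorem lppState_eq_iff (g : Site n → ℕ) (x : State n) :
    lppState g = x ↔ g = fun s => incr x s.1.1 s.1.2 := by
  constructor
  · rintro rfl
    funext ⟨⟨i, j⟩, h⟩
    simp only [incr, coord_lppState g h, Nat.add_sub_cancel_right]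
  · rintro rfl
    refine state_ext fun i j hij => ?_
    have key : ∀ m i j, 1 ≤ i → 1 ≤ j → n + 1 - (i + j) < m →
        coord (lppState fun s : Site n => incr x s.1.1 s.1.2) i j = coord x i j := by
      intro m
      induction m with
      | zero => intro i j _ _ h; omega
      | succ m ih =>
        intro i j hi hj hm
        by_cases hij : (i, j) ∈ triangle n
        · have hrec : ∀ i j, 1 ≤ i → 1 ≤ j → n + 2 ≤ i + j + m →
              coord (lppState fun s : Site n => incr x s.1.1 s.1.2) i j = coord x i j := by
            intro i j hi hj hs
            by_cases hij : (i, j) ∈ triangle n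
            · rw [mem_triangle] at hij
              exact ih i j hi hj (by omega)
            · rw [coord_of_notMem _ hij, coord_of_notMem _ hij]
          have h1 := coord_succ_left x hi j
          have h2 := coord_succ_right x i hj
          have hij' := mem_triangle.1 hij
          rw [coord_lppState _ hij, hrec (i + 1) j (by omega) hj (by omega),
            hrec i (j + 1) hi (by omega) (by omega)]
          exact Nat.sub_add_cancel (max_le h1 h2)
        · rw [coord_of_notMem _ hij, coord_of_notMem _ hij]
    have hij' := mem_triangle.1 hij
    exact key _ i j hij'.1 hij'.2.1 (Nat.lt_succ_self _)

/-- The geometric distribution with weights `(1 - w) w^k`. -/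
def geometric (w : ℝ) : Measure ℕ :=
  Measure.sum fun k => ENNReal.ofReal ((1 - w) * w ^ k) • Measure.dirac k

theorem geometric_singleton (w : ℝ) (k : ℕ) :
    geometric w {k} = ENNReal.ofReal ((1 - w) * w ^ k) :=
  Measure.sum_smul_dirac_singleton

theorem isProbabilityMeasure_geometric {w : ℝ} (h0 : 0 ≤ w) (h1 : w < 1) :
    IsProbabilityMeasure (geometric w) := by
  have hs := (hasSum_geometric_of_lt_one h0 h1).mul_left (1 - w)
  rw [mul_inv_cancel₀ (sub_pos.2 h1).ne'] at hs
  refine ⟨?_⟩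
  rw [← tsum_singleton]
  simp_rw [geometric_singleton]
  rw [← ENNReal.ofReal_tsum_of_nonneg _ hs.summable, hs.tsum_eq, ENNReal.ofReal_one]
  exact fun k => mul_nonneg (sub_pos.2 h1).le (pow_nonneg h0 k)

variable {v : ℕ → ℝ}

theorem envParam_mem (hv : ∀ k ∈ Finset.Icc 1 n, 0 < v k ∧ v k < 1) {i j : ℕ}
    (hij : (i, j) ∈ triangle n) : 0 < envParam n v i j ∧ envParam n v i j < 1 := by
  rw [mem_triangle] at hij
  have h1 := hv i (by rw [Finset.mem_Icc]; omega)
  have h2 := hv (n - j + 1) (by rw [Finset.mem_Icc]; omega)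
  exact ⟨mul_pos h1.1 h2.1, mul_lt_one_of_nonneg_of_lt_one_left h1.1.le h1.2 h2.2.le⟩

/-- The law of the geometric environment. -/
def envLaw (n : ℕ) (v : ℕ → ℝ) : Measure (Site n → ℕ) :=
  Measure.pi fun s : Site n => geometric (envParam n v s.1.1 s.1.2)

/-- The law of the field of last passage times. -/
def lppLaw (n : ℕ) (v : ℕ → ℝ) : Measure (State n) := (envLaw n v).map lppState

theorem isProbabilityMeasure_lppLaw (hv : ∀ k ∈ Finset.Icc 1 n, 0 < v k ∧ v k < 1) :
    IsProbabilityMeasure (lppLaw n v) := by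
  have := fun s : Site n => isProbabilityMeasure_geometric (envParam_mem hv s.2).1.le
    (envParam_mem hv s.2).2
  have : IsProbabilityMeasure (envLaw n v) := by unfold envLaw; infer_instance
  exact Measure.isProbabilityMeasure_map (Measurable.of_discrete).aemeasurable

theorem lppLaw_singleton (hv : ∀ k ∈ Finset.Icc 1 n, 0 < v k ∧ v k < 1) (x : State n) :
    lppLaw n v {x} = ENNReal.ofReal (weight n v x) := by
  have := fun s : Site n => isProbabilityMeasure_geometric (envParam_mem hv s.2).1.le
    (envParam_mem hv s.2).2
  have hpre : lppState ⁻¹' {x} = {fun s : Site n => incr x s.1.1 s.1.2} := by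
    ext g
    simp [lppState_eq_iff]
  rw [lppLaw, Measure.map_apply (Measurable.of_discrete) (measurableSet_singleton x), hpre, envLaw,
    Measure.pi_singleton, weight, ENNReal.ofReal_prod_of_nonneg]
  · rw [← Finset.prod_coe_sort (triangle n)]
    exact Finset.prod_congr rfl fun s _ => geometric_singleton _ _
  · intro s hs
    have := envParam_mem hv (i := s.1) (j := s.2) hs
    exact mul_nonneg (sub_pos.2 this.2).le (pow_nonneg this.1.le _)

theorem lppLaw_real (hv : ∀ k ∈ Finset.Icc 1 n, 0 < v k ∧ v k < 1) (x : State n) :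
    (lppLaw n v).real {x} = weight n v x := by
  rw [measureReal_def, lppLaw_singleton hv, ENNReal.toReal_ofReal]
  exact Finset.prod_nonneg fun s hs => mul_nonneg (sub_pos.2 (envParam_mem hv hs).2).le
    (pow_nonneg (envParam_mem hv hs).1.le _)

theorem lppLaw_reverse (hv : ∀ k ∈ Finset.Icc 1 n, 0 < v k ∧ v k < 1) :
    (lppLaw n (reverse n v)).map (transpose n).symm = lppLaw n v := by
  refine Measure.ext_of_singleton fun x => ?_
  rw [Measure.map_apply (Measurable.of_discrete) (measurableSet_singleton x), lppLaw_singleton hv]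
  have hpre : (transpose n).symm ⁻¹' {x} = {transpose n x} := by
    ext y
    simp [Equiv.symm_apply_eq]
  rw [hpre, lppLaw_singleton (reverse_mem hv), weight_reverse_transpose]

theorem IsGeometricEnvironment.map_eq {Ω : Type*} [MeasurableSpace Ω] {μ : Measure Ω} [IsProbabilityMeasure μ]
    {g : Site n → Ω → ℕ} (hg : IsGeometricEnvironment n v μ g) :
    μ.map (fun ω s => g s ω) = envLaw n v := by
  rw [(iIndepFun_iff_map_fun_eq_pi_map fun s => (hg.measurable s).aemeasurable).1 hg.indep, envLaw]
  congr 1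
  funext s
  refine Measure.ext_of_singleton fun k => ?_
  rw [Measure.map_apply (hg.measurable s) (measurableSet_singleton k), geometric_singleton,
    ← ofReal_measureReal]
  exact congrArg ENNReal.ofReal (hg.law s k)

theorem map_val_lppLaw {Ω : Type*} [MeasurableSpace Ω] {μ : Measure Ω} [IsProbabilityMeasure μ]
    {g : Site n → Ω → ℕ} (hg : IsGeometricEnvironment n v μ g) :
    (lppLaw n v).map Subtype.val = μ.map (fun ω s => lpp (fun r => g r ω) s) := by
  rw [lppLaw, ← hg.map_eq, Measure.map_map measurable_subtype_coe (Measurable.of_discrete),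
    Measure.map_map (Measurable.of_discrete) (measurable_pi_lambda _ hg.measurable)]
  rfl

end LastPassage

/-! ### Bounded rates, the reversed semigroup and the unique invariant law -/

section Stationarity

variable {n : ℕ} {v : ℕ → ℝ}

/-- One constant serves both families, so that both semigroups are mixtures over the same Poisson
law and can be compared term by term. -/
theorem exists_isBoundedRate (hn : 1 ≤ n) (hv : ∀ k ∈ Finset.Icc 1 n, 0 < v k ∧ v k < 1) :
    ∃ C : ℝ≥0, 0 < C ∧ IsBoundedRate (rate n v) C ∧ IsBoundedRate (rate n (reverse n v)) C := by
  set B := ∑ s ∈ triangle n, ((|v (n - s.2 + 1)| * (|(v (n - s.2 + 1) * v (s.1 - 1))⁻¹| + 1)) +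
      |(v (n - s.2 + 1))⁻¹| * (|v (s.1 - 1) * v (n - s.2 + 1)| + 1)) with hB
  have hB0 : 0 ≤ B := Finset.sum_nonneg fun s _ => by positivity
  refine ⟨(B + 1).toNNReal, Real.toNNReal_pos.2 (by linarith),
    ⟨rate_nonneg hv, rate_self v, finite_support_rate v, fun x => ?_⟩,
    ⟨rate_nonneg (reverse_mem hv), rate_self _, finite_support_rate _, fun x => ?_⟩⟩
  · rw [Real.coe_toNNReal _ (by linarith), (hasSum_rate v x).tsum_eq]
    have := exitRate_le v x
    linarith
  · rw [Real.coe_toNNReal _ (by linarith), (hasSum_rate _ x).tsum_eq]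
    have h1 := exitRate_le v (transpose n x)
    rw [exitRate_transpose hn hv, transpose_transpose] at h1
    linarith

/-- The semigroups with parameters `v` and `v` in reverse order are, after transposition, reversals
of one another with respect to the law of the last passage times. -/
theorem exists_reversal (hn : 1 ≤ n) (hv : ∀ k ∈ Finset.Icc 1 n, 0 < v k ∧ v k < 1) :
    ∃ P P' : ℝ≥0 → Kernel (State n) (State n),
      IsTransitionFunction (rate n v) P ∧ IsTransitionFunction (rate n (reverse n v)) P' ∧
      (∀ t, IsReversal (lppLaw n v) (transpose n) (P t) (P' t)) ∧
      ∀ x, P 1 x {⟨fun _ => 0, by simp⟩} ≠ 0 := by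
  obtain ⟨C, hC, hq, hq'⟩ := exists_isBoundedRate hn hv
  have := isProbabilityMeasure_lppLaw hv
  refine ⟨_, _, isTransitionFunction_poissonize hq hC, isTransitionFunction_poissonize hq' hC,
    fun t => (isReversal_jumpKernel (fun x => ?_) fun x y => ?_).poissonize _, fun x => ?_⟩
  · rw [(hasSum_rate v x).tsum_eq, (hasSum_rate _ _).tsum_eq, exitRate_transpose hn hv]
  · rw [lppLaw_real hv, lppLaw_real hv, weight_mul_rate hv]
  · obtain ⟨m, hm⟩ := exists_pow_jumpKernel_ne_zero hq hC (reflTransGen_zero hv x)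
    exact poissonize_singleton_ne_zero (by rwa [mul_one]) hm

theorem IsTransitionFunction.rate_unique (hn : 1 ≤ n)
    (hv : ∀ k ∈ Finset.Icc 1 n, 0 < v k ∧ v k < 1) {P P' : ℝ≥0 → Kernel (State n) (State n)}
    (hP : IsTransitionFunction (rate n v) P) (hP' : IsTransitionFunction (rate n v) P') :
    P = P' := by
  obtain ⟨C, -, hq, -⟩ := exists_isBoundedRate hn hv
  exact hP.unique hP' hq

/-- Existence comes from the reversal. For uniqueness the time-one kernel suffices, as it charges
the empty array from every state. -/
theorem isInvariantLaw_iff (hn : 1 ≤ n) (hv : ∀ k ∈ Finset.Icc 1 n, 0 < v k ∧ v k < 1)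
    {P : ℝ≥0 → Kernel (State n) (State n)} (hP : IsTransitionFunction (rate n v) P)
    (π : Measure (State n)) : IsInvariantLaw P π ↔ π = lppLaw n v := by
  obtain ⟨P₀, P', hP₀, hP', hrev, hpos⟩ := exists_reversal hn hv
  obtain rfl := hP.rate_unique hn hv hP₀
  have hM := hP.isMarkovKernel
  have hM' := hP'.isMarkovKernel
  have hprob := isProbabilityMeasure_lppLaw hv
  have hinv : IsInvariantLaw P (lppLaw n v) := ⟨hprob, fun t => (hrev t).invariant⟩
  refine ⟨fun h => ?_, fun h => h ▸ hinv⟩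
  have := h.1
  exact invariant_unique hpos (h.2 1) (hinv.2 1)

end Stationarity

end PushBlock

end

theorem theorem3 (n : ℕ) (hn : 1 ≤ n) (v : ℕ → ℝ)
    (hv : ∀ k ∈ Finset.Icc 1 n, 0 < v k ∧ v k < 1) :
    -- the rates determine a Markov semigroup
    (∃! P : ℝ≥0 → Kernel (PushBlock.State n) (PushBlock.State n),
      PushBlock.IsTransitionFunction (PushBlock.rate n v) P) ∧
    -- it has a unique invariant law, which is the law of the field of last passage times
    (∀ P : ℝ≥0 → Kernel (PushBlock.State n) (PushBlock.State n),
      PushBlock.IsTransitionFunction (PushBlock.rate n v) P →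
      ∃ π : Measure (PushBlock.State n),
        PushBlock.IsInvariantLaw P π ∧
        (∀ π' : Measure (PushBlock.State n), PushBlock.IsInvariantLaw P π' → π' = π) ∧
        ∀ {Ω : Type*} [MeasurableSpace Ω] (μ : Measure Ω) [IsProbabilityMeasure μ]
          (g : PushBlock.Site n → Ω → ℕ), PushBlock.IsGeometricEnvironment n v μ g →
          π.map Subtype.val = μ.map (fun ω s => PushBlock.lpp (fun r => g r ω) s)) ∧
    -- dynamical reversibility in stationarity
    ∀ {Ω : Type*} [MeasurableSpace Ω] (μ : Measure Ω) [IsProbabilityMeasure μ]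
      {Ω' : Type*} [MeasurableSpace Ω'] (μ' : Measure Ω') [IsProbabilityMeasure μ']
      (X : ℝ → Ω → PushBlock.State n) (X' : ℝ → Ω' → PushBlock.State n),
      PushBlock.IsStationaryMarkov (PushBlock.rate n v) μ X →
      PushBlock.IsStationaryMarkov (PushBlock.rate n (fun k => v (n + 1 - k))) μ' X' →
      μ.map (fun ω (t : ℝ) (s : PushBlock.Site n) => (X t ω).1 s) =
        μ'.map (fun ω (t : ℝ) (s : PushBlock.Site n) => (X' (-t) ω).1 s.swap) := by
  obtain ⟨P, P', hP, hP', hrev, -⟩ := PushBlock.exists_reversal hn hv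
  refine ⟨⟨P, hP, fun Q hQ => hQ.rate_unique hn hv hP⟩, fun Q hQ => ?_, ?_⟩
  · exact ⟨PushBlock.lppLaw n v, (PushBlock.isInvariantLaw_iff hn hv hQ _).2 rfl,
      fun π' => (PushBlock.isInvariantLaw_iff hn hv hQ π').1,
      fun μ _ g hg => PushBlock.map_val_lppLaw hg⟩
  intro Ω _ μ _ Ω' _ μ' _ X X' hX hX'
  have hv' := PushBlock.reverse_mem hv
  obtain ⟨Q, hQ, hmarkov⟩ := hX.markov
  obtain ⟨Q', hQ', hmarkov'⟩ := hX'.markov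
  -- The transition functions of the two processes are not given in advance; uniqueness identifies
  -- them with the pair known to be reversals of each other.
  obtain rfl := hQ.rate_unique hn hv hP
  obtain rfl := PushBlock.IsTransitionFunction.rate_unique hn hv' hQ' hP'
  have hπ : ∀ t, μ.map (X t) = PushBlock.lppLaw n v := fun t =>
    (PushBlock.isInvariantLaw_iff hn hv hQ _).1 (PushBlock.HasMarkovProperty.invariant hmarkov
      hX.measurable hQ.isMarkovKernel hX.stationary t)
  have hπ' : ∀ t, (μ'.map (X' t)).map (PushBlock.transpose n).symm = PushBlock.lppLaw n v := by
    intro t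
    rw [(PushBlock.isInvariantLaw_iff hn hv' hQ' _).1 (PushBlock.HasMarkovProperty.invariant hmarkov'
      hX'.measurable hQ'.isMarkovKernel hX'.stationary t), PushBlock.lppLaw_reverse hv]
  have hpath := PushBlock.HasMarkovProperty.map_path_eq hmarkov hmarkov' hX.measurable
    hX'.measurable hQ.isMarkovKernel hQ'.isMarkovKernel hπ hπ' hrev
  have hval : Measurable fun (f : ℝ → PushBlock.State n) (t : ℝ) => (f t).1 :=
    measurable_pi_lambda _ fun t => measurable_subtype_coe.comp (measurable_pi_apply t)
  have hrevpath : Measurable fun ω (t : ℝ) => (PushBlock.transpose n).symm (X' (-t) ω) :=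
    measurable_pi_lambda _ fun t => Measurable.of_discrete.comp (hX'.measurable _)
  -- Forget that the paths take values in the state space; transposing an array is reading it at the
  -- swapped sites.
  have h := congrArg (Measure.map fun (f : ℝ → PushBlock.State n) (t : ℝ) => (f t).1) hpath
  rw [Measure.map_map hval (measurable_pi_lambda _ hX.measurable),
    Measure.map_map hval hrevpath] at h
  exact h
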